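/- Fix an integer $B\ge 2$ and a real number $0\le p\le 1$. For $h\ge 2$ let $n=Bh$, and let $n$ Boolean variables be partitioned into $B$ communities of size $h$. Let $P_{(1,1)}$ be the uniform distribution on the 2-clauses (disjunctions of two literals on two distinct variables) whose two variables lie in different communities, and $P_{(2)}$ the uniform distribution on the 2-clauses whose two variables lie in the same community. Let $F\left(n,m,B,pP_{(1,1)}+(1-p)P_{(2)}\right)$ be the random formula that is the conjunction of $m$ independent clauses, each with distribution $pP_{(1,1)}+(1-p)P_{(2)}$. "With high probability" (w.h.p.) means with probability tending to $1$ as $n\to\infty$ along the multiples of $B$. Then the satisfiability threshold of this model is $1$. That is, $$\sup\{\alpha\ge 0:\ F\left(n,\lfloor\alpha n\rfloor,B,pP_{(1,1)}+(1-p)P_{(2)}\right)\text{ is satisfiable w.h.p.}\}=1,$$ $$\inf\{\alpha\ge 0:\ F\left(n,\lfloor\alpha n\rfloor,B,pP_{(1,1)}+(1-p)P_{(2)}\right)\text{ is unsatisfiable w.h.p.}\}=1.$$ Moreover, for every choice of clause numbers $m=m(n)$ with $m/n\to r$, a random formula from $F\left(n,m,B,pP_{(1,1)}+(1-p)P_{(2)}\right)$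 is satisfiable w.h.p. if $r<1$, and unsatisfiable w.h.p. if $r>1$. -/

import Mathlib

open MeasureTheory Filter Topology

namespace CommunitySat

/-- The `n = B * h` Boolean variables, split into `B` communities of size `h`:
`(i, a)` is the `a`-th variable of the `i`-th community. -/
abbrev Var (B h : ℕ) : Type := Fin B × Fin h

/-- A literal: `(v, true)` is the variable `v` and `(v, false)` is its negation. -/
abbrev Literal (B h : ℕ) : Type := Var B h × Bool

/-- A clause is the disjunction of a finite set of literals. -/
abbrev Clause (B h : ℕ) : Type := Finset (Literal B h)

/-- Every set of clauses is measurable. -/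
instance (B h : ℕ) : MeasurableSingletonClass (Clause B h) where
  measurableSet_singleton a := by
    have hl (l : Literal B h) : MeasurableSet {C : Clause B h | l ∈ C} :=
      measurableSet_setOfPred.2
        ((measurable_finset_iff (g := (id : Clause B h → Clause B h))).1 measurable_id l)
    have ha : ({a} : Set (Clause B h)) = ⋂ l : Literal B h, {C | l ∈ C ↔ l ∈ a} := by
      ext C
      simp [Finset.ext_iff]
    rw [ha]
    refine MeasurableSet.iInter fun l => ?_
    by_cases h : l ∈ a
    · simpa [h] using hl l
    · simp only [h, iff_false]
      exact (hl l).compl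

/-- The clauses of type `K = (k₁, …, k_ℓ)`: clauses of length `k₁ + ⋯ + k_ℓ` in distinct variables,
of which `k_j` come from a community `i_j`, where `i₁, …, i_ℓ` are distinct communities. -/
def clausesOfType (B h : ℕ) (K : List ℕ) : Set (Clause B h) :=
  {C | (∀ l ∈ C, ∀ l' ∈ C, l.1 = l'.1 → l = l') ∧ C.card = K.sum ∧
    ∃ i : Fin K.length ↪ Fin B, ∀ j, (C.filter fun l => l.1.1 = i j).card = K.get j}

/-- The uniform probability measure `P_K` on the clauses of type `K`. -/
noncomputable def typeMeasure (B h : ℕ) (K : List ℕ) : Measure (Clause B h) :=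
  ProbabilityTheory.uniformOn (clausesOfType B h K)

/-- The mixture `p P_(1,1) + (1 - p) P_(2)`. -/
noncomputable def mixedMeasure (p : ℝ) (B h : ℕ) : Measure (Clause B h) :=
  ENNReal.ofReal p • typeMeasure B h [1, 1] + ENNReal.ofReal (1 - p) • typeMeasure B h [2]

/-- An instance with `m` clauses: the conjunction of a sequence of `m` clauses. -/
abbrev Formula (B h m : ℕ) : Type := Fin m → Clause B h

/-- The law `F(n, m, B, P)`, `n = B * h`: `m` independent clauses, each with law `P`. -/
noncomputable def randomFormula {B h : ℕ} (m : ℕ) (P : Measure (Clause B h)) :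
    Measure (Formula B h m) :=
  Measure.pi fun _ => P

/-- Some truth assignment makes at least one literal of every clause true. -/
def Formula.Satisfiable {B h m : ℕ} (I : Formula B h m) : Prop :=
  ∃ σ : Var B h → Bool, ∀ c, ∃ l ∈ I c, σ l.1 = l.2

/-- For fixed `B`, clause laws `P h` and numbers `m h` of clauses, a random formula is satisfiable
with high probability as the number `n = B * h` of variables tends to infinity. -/
def SatWhp (B : ℕ) (P : (h : ℕ) → Measure (Clause B h)) (m : ℕ → ℕ) : Prop :=
  Tendsto (fun h => randomFormula (m h) (P h) {I | Formula.Satisfiable I}) atTop (𝓝 1)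

/-- As `SatWhp`, for unsatisfiability. -/
def UnsatWhp (B : ℕ) (P : (h : ℕ) → Measure (Clause B h)) (m : ℕ → ℕ) : Prop :=
  Tendsto (fun h => randomFormula (m h) (P h) {I | ¬ Formula.Satisfiable I}) atTop (𝓝 1)

/-- The number `⌊α n⌋` of clauses at density `α`, where `n = B * h`. -/
noncomputable def clausesAtDensity (B : ℕ) (α : ℝ) (h : ℕ) : ℕ := ⌊α * ((B * h : ℕ) : ℝ)⌋₊

/-- `r` is the satisfiability threshold: the supremum of the densities at which a random formula
is satisfiable with high probability and the infimum of the densities at which it is unsatisfiable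
with high probability both equal `r`. -/
def IsSatThreshold (B : ℕ) (P : (h : ℕ) → Measure (Clause B h)) (r : ℝ) : Prop :=
  IsLUB {α : ℝ | 0 ≤ α ∧ SatWhp B P (clausesAtDensity B α)} r ∧
  IsGLB {α : ℝ | 0 ≤ α ∧ UnsatWhp B P (clausesAtDensity B α)} r

end CommunitySat

/-!
The threshold of random 2-SAT with communities is `1`, whatever the mixture of clauses inside and
across communities. Only three features of the clause law matter (`IsSpreadLaw`): clauses have two
literals on distinct variables, every literal occurs in a random clause with the same probability
`1 / n`, and no clause has probability more than `K / n ^ 2`. Thus the clauses `¬a ∨ b`, read as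
edges `a → b` of the implication digraph on the literals, give every literal an expected
out-degree of about `m / n`.

*Below density one.* If a formula is unsatisfiable, some variable `x` satisfies `x →* ¬x →* x`
(`exists_assignment_of_no_contradiction`), and then the formula contains a bicycle
(`exists_isBicycle`): a path through `N + 1` distinct variables together with two further clauses
that join its ends to variables of the path. Summing the probabilities over all paths with the
marginals `1 / n`, and bounding each of the two closing clauses by `K / n ^ 2`, the expected number
of bicycles is `O (∑ N, (N + 1) ^ 2 * (m / n) ^ N / n)`, which tends to `0`
(`prob_not_satisfiable_le`).

*Above density one.* Run a depth-first search of the implication digraph (after Krivelevich and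
Sudakov) until `k = δ n` variables have been visited. The stack is a path; if it is short, then
almost `k` literals are finished, so that the queried clauses have total probability close to
`k / n`, and about `k * m / n > k` of them should be present. But each clause found present adds a
variable, so there are at most `k`. This is a large deviation, and it is bounded by an exponential
potential that does not increase when a query splits into its two answers
(`searchPotential_insert_add_insert_le`, `IsSearchState.prob_le_searchPotential`). The conditional
laws of the answers never enter, since the probability of any set of answers is at most a product
weight (`prob_contains_avoids_le`). Hence there is a path through a positive fraction of the
variables (`exists_tendsto_prob_not_hasLongPath`).

A small proportion of the clauses is kept aside. A clause inside the first half of the path makes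
the whole second half true, and a clause inside the negation of the second half makes one of its
literals false, so together they are contradictory (`not_satisfiable_of_path`). Each clause kept
aside is of either kind with probability bounded below (`exists_le_prob_clause_subset`): if `p < 1`
because of the pairs of variables in one community, and if `p = 1` because the path alternates
between different communities.
-/

namespace CommunitySat

/-! ### The implication digraph and bicycles -/

lemma pair_eq_pair_iff {α : Type*} [DecidableEq α] {a b c d : α} :
    ({a, b} : Finset α) = {c, d} ↔ (a = c ∧ b = d) ∨ (a = d ∧ b = c) := by
  constructor
  · intro h
    have h1 : a ∈ ({c, d} : Finset α) := h ▸ by simp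
    have h2 : b ∈ ({c, d} : Finset α) := h ▸ by simp
    have h3 : c ∈ ({a, b} : Finset α) := h ▸ by simp
    have h4 : d ∈ ({a, b} : Finset α) := h ▸ by simp
    simp only [Finset.mem_insert, Finset.mem_singleton] at h1 h2 h3 h4
    grind
  · rintro (⟨rfl, rfl⟩ | ⟨rfl, rfl⟩)
    · rfl
    · exact Finset.pair_comm _ _

/-- The complementary literal. -/
def neg {V : Type*} (a : V × Bool) : V × Bool := (a.1, !a.2)

@[simp] lemma neg_neg {V : Type*} (a : V × Bool) : neg (neg a) = a := by simp [neg]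

@[simp] lemma neg_fst {V : Type*} (a : V × Bool) : (neg a).1 = a.1 := rfl

lemma neg_ne {V : Type*} (a : V × Bool) : neg a ≠ a := by
  intro h
  simpa [neg] using congrArg Prod.snd h

/-- The edge `a → b` of the implication digraph of the set of clauses `F`: the clause `¬a ∨ b`
belongs to `F`. -/
def Implies {V : Type*} [DecidableEq V] (F : Set (Finset (V × Bool))) (a b : V × Bool) : Prop :=
  {neg a, b} ∈ F

lemma Implies.contrapose {V : Type*} [DecidableEq V] {F : Set (Finset (V × Bool))}
    {a b : V × Bool} (h : Implies F a b) : Implies F (neg b) (neg a) := by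
  unfold Implies at *
  rwa [neg_neg, Finset.pair_comm]

/-- Reachability in the implication digraph. -/
abbrev Reach {V : Type*} [DecidableEq V] (F : Set (Finset (V × Bool))) :
    V × Bool → V × Bool → Prop :=
  Relation.ReflTransGen (Implies F)

lemma Reach.contrapose {V : Type*} [DecidableEq V] {F : Set (Finset (V × Bool))}
    {a b : V × Bool} (h : Reach F a b) : Reach F (neg b) (neg a) := by
  induction h with
  | refl => exact .refl
  | tail _ h ih => exact .head h.contrapose ih

/-- A set of literals that is closed under implication and consistent, and does not contain `¬x`,
remains so when everything that follows from `x` is added, unless `x` implies `¬x`. -/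
lemma exists_larger_closed_consistent {V : Type*} [DecidableEq V] {F : Set (Finset (V × Bool))}
    {S : Set (V × Bool)} (hc : ∀ a b, a ∈ S → Implies F a b → b ∈ S)
    (hn : ∀ a, a ∈ S → neg a ∉ S) {x : V × Bool} (hx' : neg x ∉ S)
    (hno : ¬ Reach F x (neg x)) :
    (∀ a b, a ∈ S ∪ {y | Reach F x y} → Implies F a b → b ∈ S ∪ {y | Reach F x y}) ∧
    (∀ a, a ∈ S ∪ {y | Reach F x y} → neg a ∉ S ∪ {y | Reach F x y}) := by
  have hc' : ∀ a b, a ∈ S → Reach F a b → b ∈ S := by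
    intro a b ha hab
    induction hab with
    | refl => exact ha
    | tail _ h ih => exact hc _ _ ih h
  refine ⟨?_, ?_⟩
  · rintro a b (ha | ha) hab
    · exact .inl (hc a b ha hab)
    · exact .inr (Relation.ReflTransGen.tail ha hab)
  · rintro a (ha | ha) (hb | hb)
    · exact hn a ha hb
    · have := Reach.contrapose hb
      rw [neg_neg] at this
      exact hx' (hc' _ _ ha this)
    · exact hx' (hc' _ _ hb (Reach.contrapose ha))
    · have := Reach.contrapose hb
      rw [neg_neg] at this
      exact hno (Relation.ReflTransGen.trans ha this)

/-- A 2-CNF formula is satisfiable if no variable is equivalent to its own negation in the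
implication digraph. -/
theorem exists_assignment_of_no_contradiction {V : Type*} [DecidableEq V] [Finite V]
    {F : Set (Finset (V × Bool))} (hF : ∀ C ∈ F, ∃ a b, C = {a, b})
    (hno : ∀ x, ¬ (Reach F x (neg x) ∧ Reach F (neg x) x)) :
    ∃ σ : V → Bool, ∀ C ∈ F, ∃ l ∈ C, σ l.1 = l.2 := by
  classical
  -- A maximal closed and consistent set of literals decides every variable.
  obtain ⟨S, ⟨hc, hn⟩, hmax⟩ := (Set.toFinite {S : Set (V × Bool) |
    (∀ a b, a ∈ S → Implies F a b → b ∈ S) ∧ ∀ a, a ∈ S → neg a ∉ S}).exists_maximal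
    ⟨∅, by simp⟩
  have key : ∀ x, neg x ∉ S → x ∉ S → Reach F x (neg x) := by
    intro x hx' hx
    by_contra h
    exact hx (hmax (exists_larger_closed_consistent hc hn hx' h) Set.subset_union_left
      (.inr .refl))
  have hdec : ∀ x, x ∈ S ∨ neg x ∈ S := by
    intro x
    by_contra! h
    refine hno x ⟨key x h.2 h.1, ?_⟩
    have := key (neg x) (by simpa using h.1) h.2
    rwa [neg_neg] at this
  have hσ : ∀ a : V × Bool, a ∈ S → decide ((a.1, true) ∈ S) = a.2 := by
    rintro ⟨v, _ | _⟩ ha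
    · have := hn _ ha
      simpa [neg] using this
    · simpa using ha
  refine ⟨fun v => decide ((v, true) ∈ S), fun C hC => ?_⟩
  obtain ⟨a, b, rfl⟩ := hF C hC
  rcases hdec a with h | h
  · exact ⟨a, by simp, hσ a h⟩
  · exact ⟨b, by simp, hσ b (hc _ _ h (by simpa [Implies] using hC))⟩

lemma exists_step_out {α : Type*} {r : α → α → Prop} {s : Set α} {a b : α}
    (h : Relation.ReflTransGen r a b) (ha : a ∈ s) (hb : b ∉ s) :
    ∃ c d, c ∈ s ∧ d ∉ s ∧ r c d ∧ Relation.ReflTransGen r a c ∧ Relation.ReflTransGen r d b := by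
  induction h using Relation.ReflTransGen.head_induction_on with
  | refl => exact absurd ha hb
  | @head a c hac hcb ih =>
    by_cases hc : c ∈ s
    · obtain ⟨e, d, h1, h2, h3, h4, h5⟩ := ih hc
      exact ⟨e, d, h1, h2, h3, .head hac h4, h5⟩
    · exact ⟨a, c, ha, hc, hac, .refl, hcb⟩

/-- A *bicycle*: a path in the implication digraph through distinct variables, from `y` to `z`,
such that an edge leaves `z` for a variable of the path, an edge enters `y` from a variable of the
path, and these two edges come from different clauses. -/
def IsBicycle {V : Type*} [DecidableEq V] (F : Set (Finset (V × Bool))) (l : List (V × Bool))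
    (y z u v : V × Bool) : Prop :=
  (l.map Prod.fst).Nodup ∧ l.IsChain (Implies F) ∧ l.head? = some y ∧ l.getLast? = some z ∧
    u.1 ∈ l.map Prod.fst ∧ v.1 ∈ l.map Prod.fst ∧ {y, u} ∈ F ∧ {neg z, v} ∈ F ∧
    ({y, u} : Finset (V × Bool)) ≠ {neg z, v}

/-- If some variable is equivalent to its negation in the implication digraph, then there is a
bicycle: a longest path through distinct variables inside the strong component can be prolonged at
neither end without repeating a variable, and if both prolongations use the same clause then the
path closes up to a cycle, which an edge must leave somewhere. -/
theorem exists_isBicycle {V : Type*} [DecidableEq V] [Finite V]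
    {F : Set (Finset (V × Bool))} {x : V × Bool} (h1 : Reach F x (neg x))
    (h2 : Reach F (neg x) x) : ∃ l y z u v, IsBicycle F l y z u v := by
  classical
  have := Fintype.ofFinite V
  -- The strong component of `x`; it is closed under negation.
  set Z : Set (V × Bool) := {z | Reach F x z ∧ Reach F z x} with hZ
  have hxZ : x ∈ Z := ⟨.refl, .refl⟩
  have hZneg : ∀ z ∈ Z, neg z ∈ Z := by
    rintro z ⟨ha, hb⟩
    exact ⟨h1.trans hb.contrapose, ha.contrapose.trans h2⟩
  have hZreach : ∀ a ∈ Z, ∀ b ∈ Z, Reach F a b := fun a ha b hb => ha.2.trans hb.1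
  have hout : ∀ s : Set (V × Bool), ∀ a ∈ Z, a ∈ s → (∃ b ∈ Z, b ∉ s) →
      ∃ c d, c ∈ s ∧ d ∉ s ∧ d ∈ Z ∧ c ∈ Z ∧ Implies F c d := by
    rintro s a haZ ha ⟨b, hbZ, hb⟩
    obtain ⟨c, d, hc, hd, hcd, hac, hdb⟩ := exists_step_out (hZreach a haZ b hbZ) ha hb
    have hcZ : Reach F x c := haZ.1.trans hac
    have hdZ : Reach F d x := hdb.trans hbZ.2
    exact ⟨c, d, hc, hd, ⟨hcZ.tail hcd, hdZ⟩, ⟨hcZ, .head hcd hdZ⟩, hcd⟩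
  let G : List (V × Bool) → Prop := fun l =>
    (l.map Prod.fst).Nodup ∧ l.IsChain (Implies F) ∧ ∀ z ∈ l, z ∈ Z
  have hGx : G [x] := ⟨by simp, by simp, fun z hz => by rwa [List.mem_singleton.1 hz]⟩
  obtain ⟨l, ⟨hnd, hch, hlZ⟩, hmax⟩ : ∃ l, G l ∧ ∀ l', G l' → l'.length ≤ l.length := by
    have hb : ∀ k, (∃ l, G l ∧ l.length = k) → k ≤ Fintype.card V := by
      rintro k ⟨l, hl, rfl⟩
      simpa using hl.1.length_le_card
    have hex : ∃ k, ∃ l, G l ∧ l.length = k := ⟨1, [x], hGx, rfl⟩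
    obtain ⟨k, hk⟩ := hex
    have hs := Nat.findGreatest_spec (P := fun k => ∃ l, G l ∧ l.length = k) (hb k hk) hk
    obtain ⟨l, hl, hlk⟩ := hs
    refine ⟨l, hl, fun l' hl' => ?_⟩
    rw [hlk]
    exact Nat.le_findGreatest (hb _ ⟨l', hl', rfl⟩) ⟨l', hl', rfl⟩
  have hne : l ≠ [] := by
    rintro rfl
    simpa using hmax [x] hGx
  obtain ⟨y, t, rfl⟩ := List.exists_cons_of_ne_nil hne
  obtain ⟨z, hz⟩ : ∃ z, (y :: t).getLast? = some z := ⟨_, List.getLast?_eq_getLast_of_ne_nil hne⟩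
  have hzmem : z ∈ y :: t := List.mem_of_getLast? hz
  have hyZ : y ∈ Z := hlZ y (by simp)
  have hzZ : z ∈ Z := hlZ z hzmem
  -- By maximality every prolongation at the end repeats a variable.
  have hend : ∀ l' : List (V × Bool), ∀ e d, G l' → l'.length = (y :: t).length →
      l'.getLast? = some e → Implies F e d → d ∈ Z → d.1 ∈ l'.map Prod.fst := by
    intro l' e d hG hlen he hed hd
    by_contra hn
    have := hmax (l' ++ [d]) ⟨?_, ?_, ?_⟩
    · simp at this hlen; omega
    · rw [List.map_append, List.nodup_append]
      refine ⟨hG.1, by simp, ?_⟩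
      intro a ha b hb hab
      simp at hb
      subst hab hb
      exact hn ha
    · rw [List.isChain_append]
      refine ⟨hG.2.1, by simp, ?_⟩
      intro a ha b hb
      rw [he] at ha
      simp at ha hb
      subst ha hb
      exact hed
    · intro w hw
      rcases List.mem_append.1 hw with hw | hw
      · exact hG.2.2 w hw
      · simp at hw; exact hw ▸ hd
  have hG0 : G (y :: t) := ⟨hnd, hch, hlZ⟩
  obtain ⟨c, v, hc, -, hvZ, -, hzv⟩ := hout {z} z hzZ rfl ⟨neg z, hZneg z hzZ, neg_ne z⟩
  obtain rfl : c = z := hc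
  obtain ⟨c', u', hc', -, hu'Z, -, hyu⟩ :=
    hout {neg y} (neg y) (hZneg y hyZ) rfl ⟨y, hyZ, fun h => neg_ne y h.symm⟩
  obtain rfl : c' = neg y := hc'
  have hv := hend _ _ _ hG0 rfl hz hzv hvZ
  have hyu' : {y, u'} ∈ F := by simpa [Implies] using hyu
  have hu : u'.1 ∈ (y :: t).map Prod.fst := by
    by_contra hn
    have := hmax (neg u' :: y :: t) ⟨?_, ?_, ?_⟩
    · simp at this
    · rw [List.map_cons, List.nodup_cons]; exact ⟨hn, hnd⟩
    · rw [List.isChain_cons_cons]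
      exact ⟨by simpa using hyu.contrapose, hch⟩
    · intro w hw
      rcases List.mem_cons.1 hw with rfl | hw
      · exact hZneg _ hu'Z
      · exact hlZ w hw
  by_cases hdist : ({y, u'} : Finset (V × Bool)) ≠ {neg c, v}
  · exact ⟨y :: t, y, c, u', v, hnd, hch, rfl, hz, hu, hv, hyu', hzv, hdist⟩
  -- The two prolongations coincide: `c → y`, so the path closes up to a cycle.
  push Not at hdist
  have hcy : Implies F c y := by
    have : y ∈ ({neg c, v} : Finset (V × Bool)) := by rw [← hdist]; simp
    rcases Finset.mem_insert.1 this with h | h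
    · -- `y = neg c` shares its variable with the end `c` of the path, so `c = y`
      exfalso
      have hcy : y.1 = c.1 := by rw [h]; rfl
      have : y = c := List.inj_on_of_nodup_map hnd (by simp) hzmem hcy
      exact neg_ne c (h ▸ this)
    · rw [Finset.mem_singleton] at h
      rw [h]; exact hzv
  have hnegy : neg y ∉ y :: t := fun h =>
    neg_ne y (List.inj_on_of_nodup_map hnd h (by simp) rfl)
  -- An edge of the strong component leaves the cycle, since `¬y` does not lie on it.
  obtain ⟨a, d, ha, hd, hdZ, haZ, had⟩ := hout {w | w ∈ y :: t} y hyZ (by simp)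
    ⟨neg y, hZneg y hyZ, hnegy⟩
  obtain ⟨l1, l2, hl⟩ := List.append_of_mem (show a ∈ y :: t from ha)
  have hd' : d ∉ y :: t := hd
  -- Rotate the cycle so that it ends in `a`.
  have hperm : (l2 ++ (l1 ++ [a])).Perm (y :: t) := by
    rw [hl]
    calc (l2 ++ (l1 ++ [a])).Perm ((l1 ++ [a]) ++ l2) := List.perm_append_comm
      _ = l1 ++ a :: l2 := by simp
  have hnd' : ((l2 ++ (l1 ++ [a])).map Prod.fst).Nodup := (hperm.map _).nodup_iff.2 hnd
  have hhead : (l1 ++ [a]).head? = some y := by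
    have := congrArg List.head? hl
    cases l1 <;> simp_all
  have hch1 : (l1 ++ [a]).IsChain (Implies F) ∧ (a :: l2).IsChain (Implies F) := by
    rw [hl] at hch
    refine ⟨?_, (List.isChain_append.1 hch).2.1⟩
    have : l1 ++ a :: l2 = (l1 ++ [a]) ++ l2 := by simp
    rw [this] at hch
    exact (List.isChain_append.1 hch).1
  have hlast2 : ∀ w ∈ l2.getLast?, w = c := by
    intro w hw
    rw [hl] at hz
    cases l2 with
    | nil => simp at hw
    | cons b l2 => simp_all
  have hch' : (l2 ++ (l1 ++ [a])).IsChain (Implies F) := by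
    rw [List.isChain_append]
    refine ⟨List.IsChain.of_cons hch1.2, hch1.1, ?_⟩
    intro w hw b hb
    rw [hhead] at hb
    obtain rfl := Option.some.inj hb
    rw [hlast2 w hw]
    exact hcy
  have hG' : G (l2 ++ (l1 ++ [a])) :=
    ⟨hnd', hch', fun w hw => hlZ w (hperm.subset hw)⟩
  have hdv := hend _ a d hG' hperm.length_eq (by simp [← List.append_assoc]) had hdZ
  obtain ⟨e, he, hae⟩ : ∃ e, (l2 ++ (l1 ++ [a])).head? = some e ∧ Implies F a e := by
    cases l2 with
    | nil =>
      refine ⟨y, by simpa using hhead, ?_⟩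
      have : (y :: t).getLast? = some a := by rw [hl]; simp
      rw [hz] at this
      obtain rfl := Option.some.inj this
      exact hcy
    | cons b l2 => exact ⟨b, rfl, (List.isChain_cons_cons.1 hch1.2).1⟩
  have hemem : e ∈ y :: t := hperm.subset (List.mem_of_head? he)
  refine ⟨l2 ++ (l1 ++ [a]), e, a, neg a, d, hnd', hch', he, by simp [← List.append_assoc],
    by simp, hdv, ?_, had, ?_⟩
  · rw [Finset.pair_comm]; exact hae
  · intro h
    have : d ∈ ({e, neg a} : Finset (V × Bool)) := by rw [h]; simp
    rcases Finset.mem_insert.1 this with h' | h'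
    · exact hd' (h' ▸ hemem)
    · rw [Finset.mem_singleton] at h'
      subst h'
      have h'' : e = neg a := by
        have : e ∈ ({neg a, neg a} : Finset (V × Bool)) := by rw [← h]; simp
        simpa using this
      exact hd' (h'' ▸ hemem)

/-! ### Random formulas -/

instance {B h m : ℕ} (P : Measure (Clause B h)) [IsProbabilityMeasure P] :
    IsProbabilityMeasure (randomFormula m P) := by
  unfold randomFormula; infer_instance

lemma satisfiable_iff {B h m : ℕ} (I : Formula B h m) :
    I.Satisfiable ↔ ∃ σ : Var B h → Bool, ∀ C ∈ Set.range I, ∃ l ∈ C, σ l.1 = l.2 := by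
  simp [Formula.Satisfiable]

/-- The probability that all clauses of `A` and no clause of `D` occur in the formula: choose, for
each clause of `A`, one position at which it occurs; the other positions avoid `D`. -/
theorem prob_contains_avoids_le {B h : ℕ} (P : Measure (Clause B h)) [IsProbabilityMeasure P]
    (m : ℕ) (A D : Finset (Clause B h)) :
    (randomFormula m P).real {I | (∀ C ∈ A, C ∈ Set.range I) ∧ ∀ C ∈ D, C ∉ Set.range I} ≤
      (∏ C ∈ A, (m * P.real {C})) * (1 - ∑ C ∈ D, P.real {C}) ^ (m - A.card) := by
  classical
  set s : (A → Fin m) → Fin m → Set (Clause B h) := fun f i =>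
    {x | (∀ C : A, f C = i → x = C) ∧ ((∀ C, f C ≠ i) → x ∉ D)} with hs
  -- `f` chooses the positions of the clauses of `A`.
  have hsub : {I : Formula B h m | (∀ C ∈ A, C ∈ Set.range I) ∧ ∀ C ∈ D, C ∉ Set.range I} ⊆
      ⋃ f : A → Fin m, Set.pi Set.univ (s f) := by
    rintro I ⟨hA, hD⟩
    choose f hf using fun C : A => hA C.1 C.2
    refine Set.mem_iUnion.2 ⟨f, fun i _ => ⟨?_, ?_⟩⟩
    · rintro C rfl
      exact hf C
    · intro _ hi
      exact hD _ hi ⟨i, rfl⟩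
  have hq : P.real (D : Set (Clause B h))ᶜ = 1 - ∑ C ∈ D, P.real {C} := by
    rw [probReal_compl_eq_one_sub D.measurableSet, sum_measureReal_singleton]
  have hpos : 0 ≤ 1 - ∑ C ∈ D, P.real {C} := hq ▸ measureReal_nonneg
  have hterm : ∀ f : A → Fin m, (randomFormula m P).real (Set.pi Set.univ (s f)) ≤
      (∏ C ∈ A, P.real {C}) * (1 - ∑ C ∈ D, P.real {C}) ^ (m - A.card) := by
    intro f
    have hR : 0 ≤ (∏ C ∈ A, P.real {C}) * (1 - ∑ C ∈ D, P.real {C}) ^ (m - A.card) :=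
      mul_nonneg (Finset.prod_nonneg fun _ _ => measureReal_nonneg) (pow_nonneg hpos _)
    by_cases hf : Function.Injective f
    · have h1 : (randomFormula m P).real (Set.pi Set.univ (s f)) = ∏ i, P.real (s f i) := by
        simp [Measure.real, randomFormula, Measure.pi_pi, ENNReal.toReal_prod]
      rw [h1, ← Finset.prod_mul_prod_compl (Finset.univ.image f)]
      apply le_of_eq
      congr 1
      · rw [Finset.prod_image (fun _ _ _ _ h => hf h), ← Finset.prod_coe_sort A]
        refine Finset.prod_congr rfl fun C _ => ?_
        congr 1
        ext x
        constructor
        · intro hx; exact hx.1 C rfl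
        · intro hx
          rw [Set.mem_singleton_iff] at hx
          refine ⟨fun C' h' => ?_, fun h' => absurd rfl (h' C)⟩
          rw [hf h']; exact hx
      · have : ∀ i ∈ (Finset.univ.image f)ᶜ, P.real (s f i) = 1 - ∑ C ∈ D, P.real {C} := by
          intro i hi
          have hi' : ∀ C, f C ≠ i := by simpa using hi
          rw [← hq]
          congr 1
          ext x
          simp [hs, hi']
        rw [Finset.prod_congr rfl this, Finset.prod_const, Finset.card_compl,
          Finset.card_image_of_injective _ hf]
        simp
    · have : Set.pi Set.univ (s f) = ∅ := by
        simp only [Function.Injective, not_forall] at hf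
        obtain ⟨C, C', hCC, hne⟩ := hf
        refine Set.eq_empty_of_forall_notMem fun I hI => hne ?_
        have := hI (f C) trivial
        exact Subtype.ext ((this.1 C rfl).symm.trans (this.1 C' hCC.symm))
      rw [this]
      simpa using hR
  calc _ ≤ (randomFormula m P).real (⋃ f : A → Fin m, Set.pi Set.univ (s f)) :=
        measureReal_mono hsub
    _ ≤ ∑ f : A → Fin m, (randomFormula m P).real (Set.pi Set.univ (s f)) :=
        measureReal_iUnion_fintype_le _
    _ ≤ ∑ f : A → Fin m, (∏ C ∈ A, P.real {C}) * (1 - ∑ C ∈ D, P.real {C}) ^ (m - A.card) :=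
        Finset.sum_le_sum fun f _ => hterm f
    _ = _ := by
        rw [Finset.sum_const, Finset.prod_mul_distrib, Finset.prod_const]
        simp [mul_assoc]

theorem prob_contains_le {B h : ℕ} (P : Measure (Clause B h)) [IsProbabilityMeasure P]
    (m : ℕ) (A : Finset (Clause B h)) :
    (randomFormula m P).real {I | ∀ C ∈ A, C ∈ Set.range I} ≤ ∏ C ∈ A, (m * P.real {C}) := by
  simpa using prob_contains_avoids_le P m A ∅

theorem prob_contains_avoids_le_exp {B h : ℕ} (P : Measure (Clause B h)) [IsProbabilityMeasure P]
    {m k : ℕ} (A D : Finset (Clause B h)) (hA : A.card ≤ k) (hk : k ≤ m) :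
    (randomFormula m P).real {I | (∀ C ∈ A, C ∈ Set.range I) ∧ ∀ C ∈ D, C ∉ Set.range I} ≤
      (∏ C ∈ A, (m * P.real {C})) * Real.exp (-((m - k) * ∑ C ∈ D, P.real {C})) := by
  refine (prob_contains_avoids_le P m A D).trans ?_
  have hq : ∑ C ∈ D, P.real {C} ≤ 1 := by
    rw [sum_measureReal_singleton]; exact measureReal_le_one
  have hq0 : 0 ≤ ∑ C ∈ D, P.real {C} := Finset.sum_nonneg fun _ _ => measureReal_nonneg
  refine mul_le_mul_of_nonneg_left ?_
    (Finset.prod_nonneg fun _ _ => mul_nonneg (Nat.cast_nonneg _) measureReal_nonneg)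
  calc (1 - ∑ C ∈ D, P.real {C}) ^ (m - A.card)
      ≤ Real.exp (-∑ C ∈ D, P.real {C}) ^ (m - A.card) :=
        pow_le_pow_left₀ (by linarith) (by linarith [Real.add_one_le_exp (-∑ C ∈ D, P.real {C})]) _
    _ = Real.exp (-(((m - A.card : ℕ) : ℝ) * ∑ C ∈ D, P.real {C})) := by
        rw [← Real.exp_nat_mul]; ring_nf
    _ ≤ _ := by
        apply Real.exp_le_exp.2
        apply neg_le_neg
        apply mul_le_mul_of_nonneg_right _ hq0
        rw [Nat.cast_sub (hA.trans hk)]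
        have : (A.card : ℝ) ≤ k := by exact_mod_cast hA
        linarith

/-- A law on clauses on `n = B * h` variables that puts its mass on two-clauses in distinct
variables, such that each literal has the same probability to occur, and such that no clause has
probability more than `K / n ^ 2`. -/
structure IsSpreadLaw {B h : ℕ} (K : ℝ) (P : Measure (Clause B h)) : Prop where
  isProb : IsProbabilityMeasure P
  support : ∀ C, P.real {C} ≠ 0 → ∃ a b : Literal B h, a.1 ≠ b.1 ∧ C = {a, b}
  marginal : ∀ a : Literal B h, ∑ b, P.real {({a, b} : Clause B h)} = 1 / ((B * h : ℕ) : ℝ)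
  le : ∀ C, P.real {C} ≤ K / ((B * h : ℕ) : ℝ) ^ 2

lemma measureReal_eq_sum_filter {B h : ℕ} (P : Measure (Clause B h)) [IsProbabilityMeasure P]
    (p : Clause B h → Prop) [DecidablePred p] :
    P.real {C | p C} = ∑ C with p C, P.real {C} := by
  rw [sum_measureReal_singleton]
  simp

/-! ### Satisfiability below density one -/

lemma tendsto_card_var {B : ℕ} (hB : 0 < B) :
    Tendsto (fun h : ℕ => ((B * h : ℕ) : ℝ)) atTop atTop :=
  tendsto_natCast_atTop_atTop.comp (tendsto_id.const_mul_atTop' hB)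

/-- The total weight of the walks with `N` steps, when the weights of the steps into each point add
up to `ρ`. -/
lemma sum_walks {α : Type*} [Fintype α] {f : α → α → ℝ} {ρ : ℝ} (hf : ∀ b, ∑ a, f a b = ρ)
    (N : ℕ) : ∑ y : Fin (N + 1) → α, ∏ i : Fin N, f (y i.castSucc) (y i.succ) =
      Fintype.card α * ρ ^ N := by
  induction N with
  | zero => simp
  | succ N ih =>
    rw [← (Fin.consEquiv fun _ => α).sum_comp, Fintype.sum_prod_type_right]
    have : ∀ y : Fin (N + 1) → α, ∑ a, ∏ i : Fin (N + 1),
        f ((Fin.consEquiv fun _ => α) (a, y) i.castSucc)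
          ((Fin.consEquiv fun _ => α) (a, y) i.succ) =
        ρ * ∏ i : Fin N, f (y i.castSucc) (y i.succ) := by
      intro y
      simp_rw [Fin.prod_univ_succ]
      simp only [Fin.consEquiv_apply, Fin.castSucc_zero, Fin.cons_zero, Fin.cons_succ,
        Fin.castSucc_succ]
      rw [← Finset.sum_mul, hf]
    rw [Finset.sum_congr rfl fun y _ => this y, ← Finset.mul_sum, ih]
    ring

/-- The clauses of the bicycle with path `y` and closing literals `u`, `v`. -/
def bicycleClauses {V : Type*} [DecidableEq V] {N : ℕ} (y : Fin (N + 1) → V × Bool)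
    (u v : V × Bool) : Finset (Finset (V × Bool)) :=
  insert {y 0, u} (insert {neg (y (Fin.last N)), v}
    (Finset.univ.image fun i : Fin N => {neg (y i.castSucc), y i.succ}))

/-- The clauses of a bicycle are pairwise distinct. -/
lemma prod_bicycleClauses {V : Type*} [DecidableEq V] {N : ℕ} {y : Fin (N + 1) → V × Bool}
    {u v : V × Bool} (hy : Function.Injective fun i => (y i).1)
    (huv : ({y 0, u} : Finset (V × Bool)) ≠ {neg (y (Fin.last N)), v})
    (g : Finset (V × Bool) → ℝ) :
    ∏ C ∈ bicycleClauses y u v, g C = g {y 0, u} * g {neg (y (Fin.last N)), v} *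
      ∏ i : Fin N, g {neg (y i.castSucc), y i.succ} := by
  have hneg : ∀ i j, y i ≠ neg (y j) := by
    intro i j hij
    have : i = j := hy ((congrArg Prod.fst hij).trans (neg_fst _))
    subst this
    exact neg_ne _ hij.symm
  have hinj : ∀ i j, y i = y j → i = j := fun i j hij => hy (congrArg Prod.fst hij)
  unfold bicycleClauses
  rw [Finset.prod_insert, Finset.prod_insert, Finset.prod_image, mul_assoc]
  · intro i _ j _ hij
    rcases pair_eq_pair_iff.1 hij with ⟨h, -⟩ | ⟨h, -⟩
    · have := hinj _ _ (by simpa using congrArg neg h : y i.castSucc = y j.castSucc)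
      exact Fin.castSucc_injective _ this
    · exact absurd h.symm (hneg _ _)
  · intro hmem
    obtain ⟨i, -, hi⟩ := Finset.mem_image.1 hmem
    have : neg (y (Fin.last N)) ∈ ({neg (y i.castSucc), y i.succ} : Finset (V × Bool)) := by
      rw [hi]; simp
    rcases Finset.mem_insert.1 this with h | h
    · have := hinj _ _ (by simpa using congrArg neg h : y (Fin.last N) = y i.castSucc)
      exact (Fin.castSucc_lt_last i).ne this.symm
    · exact hneg _ _ (Finset.mem_singleton.1 h).symm
  · intro hmem
    rcases Finset.mem_insert.1 hmem with h | h
    · exact huv h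
    · obtain ⟨i, -, hi⟩ := Finset.mem_image.1 h
      have : y 0 ∈ ({neg (y i.castSucc), y i.succ} : Finset (V × Bool)) := by
        rw [hi]; simp
      rcases Finset.mem_insert.1 this with h | h
      · exact hneg _ _ h
      · exact Fin.succ_ne_zero i (hinj _ _ (Finset.mem_singleton.1 h)).symm

lemma IsBicycle.exists_fin {V : Type*} [DecidableEq V] [Fintype V] {F : Set (Finset (V × Bool))}
    {l : List (V × Bool)} {a b u v : V × Bool} (hb : IsBicycle F l a b u v) :
    ∃ N, N < Fintype.card V ∧ ∃ y : Fin (N + 1) → V × Bool, ∃ j j' : Fin (N + 1), ∃ s s' : Bool,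
      Function.Injective (fun i => (y i).1) ∧
      ({y 0, ((y j).1, s)} : Finset (V × Bool)) ≠ {neg (y (Fin.last N)), ((y j').1, s')} ∧
      ∀ C ∈ bicycleClauses y ((y j).1, s) ((y j').1, s'), C ∈ F := by
  obtain ⟨hnd, hch, ha, hz, hu, hv, hau, hzv, hne⟩ := hb
  have hlen : l.length ≤ Fintype.card V := by simpa using hnd.length_le_card
  obtain ⟨t, rfl⟩ : ∃ t, l = a :: t := by
    cases l with
    | nil => simp at ha
    | cons c t => exact ⟨t, by simpa using ha⟩
  have hlen' : t.length + 1 ≤ Fintype.card V := by simpa using hlen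
  have hget : ∀ w : V × Bool, w.1 ∈ (a :: t).map Prod.fst →
      ∃ j : Fin (t.length + 1), ((a :: t).get j).1 = w.1 := by
    intro w hw
    obtain ⟨c, hc, hcw⟩ := List.mem_map.1 hw
    obtain ⟨j, hj⟩ := List.get_of_mem hc
    exact ⟨j, by rw [← hcw, ← hj]⟩
  obtain ⟨j, hj⟩ := hget u hu
  obtain ⟨j', hj'⟩ := hget v hv
  have hlast : (a :: t).get (Fin.last t.length) = b := by
    rw [List.getLast?_eq_getLast_of_ne_nil (List.cons_ne_nil _ _)] at hz
    rw [← Option.some.inj hz, List.getLast_eq_getElem]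
    simp
  refine ⟨t.length, by omega, (a :: t).get, j, j', u.2, v.2, ?_, ?_, ?_⟩
  · intro i i' hii
    have h1 := List.inj_on_of_nodup_map hnd (List.get_mem (a :: t) i) (List.get_mem (a :: t) i') hii
    exact (List.nodup_iff_injective_get.1 (List.Nodup.of_map _ hnd)) h1
  · rw [hlast, hj, hj']
    exact hne
  · rw [hj, hj']
    intro C hC
    unfold bicycleClauses at hC
    rw [hlast] at hC
    simp only [Finset.mem_insert, Finset.mem_image, Finset.mem_univ, true_and] at hC
    rcases hC with rfl | rfl | ⟨i, rfl⟩
    · exact hau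
    · exact hzv
    · have := List.isChain_iff_getElem.1 hch i (by simp)
      exact this

/-- The first moment bound: the probability that a formula contains a bicycle. -/
theorem prob_not_satisfiable_le {B h : ℕ} {K : ℝ} {P : Measure (Clause B h)}
    (hP : IsSpreadLaw K P) (m : ℕ) :
    (randomFormula m P).real {I | ¬ I.Satisfiable} ≤
      ∑ N ∈ Finset.range (B * h), (2 * (B * h : ℕ)) * ((m : ℝ) / (B * h : ℕ)) ^ N *
        ((2 * (N + 1)) ^ 2 * (m * (K / ((B * h : ℕ) : ℝ) ^ 2)) ^ 2) := by
  classical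
  have := hP.isProb
  set κ : ℝ := m * (K / ((B * h : ℕ) : ℝ) ^ 2) with hκ
  have hκle : ∀ C : Clause B h, m * P.real {C} ≤ κ := fun C =>
    mul_le_mul_of_nonneg_left (hP.le C) (Nat.cast_nonneg m)
  have hnn : ∀ C : Clause B h, 0 ≤ m * P.real {C} := fun C =>
    mul_nonneg (Nat.cast_nonneg m) measureReal_nonneg
  -- A potential bicycle: its path, and for each closing literal a position on the path and a sign.
  let ι : ℕ → Type := fun N =>
    (Fin (N + 1) → Literal B h) × ((Fin (N + 1) × Bool) × (Fin (N + 1) × Bool))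
  let E : (N : ℕ) → ι N → Set (Formula B h m) := fun N x =>
    {I | Function.Injective (fun i => (x.1 i).1) ∧
      ({x.1 0, ((x.1 x.2.1.1).1, x.2.1.2)} : Clause B h) ≠
        {neg (x.1 (Fin.last N)), ((x.1 x.2.2.1).1, x.2.2.2)} ∧
      ∀ C ∈ bicycleClauses x.1 ((x.1 x.2.1.1).1, x.2.1.2) ((x.1 x.2.2.1).1, x.2.2.2),
        C ∈ Set.range I}
  let Z : Set (Formula B h m) :=
    ⋃ C ∈ Finset.univ.filter (fun C => P.real {C} = 0),
      {I | ∀ C' ∈ ({C} : Finset _), C' ∈ Set.range I}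
  -- formulas with a clause of probability zero
  have hZ : (randomFormula m P).real Z ≤ 0 := by
    refine (measureReal_biUnion_finset_le _ _).trans (Finset.sum_nonpos fun C hC => ?_)
    refine (prob_contains_le P m {C}).trans ?_
    simp [(Finset.mem_filter.1 hC).2]
  have hsub : {I : Formula B h m | ¬ I.Satisfiable} ⊆
      Z ∪ ⋃ N ∈ Finset.range (B * h), ⋃ x : ι N, E N x := by
    intro I hI
    by_cases hIZ : ∃ i, P.real {I i} = 0
    · obtain ⟨i, hi⟩ := hIZ
      refine .inl (Set.mem_biUnion (x := I i) (by simpa using hi) ?_)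
      intro C' hC'
      exact ⟨i, (Finset.mem_singleton.1 hC').symm⟩
    · right
      push Not at hIZ
      rw [Set.mem_ofPred_eq, satisfiable_iff] at hI
      have hpair : ∀ C ∈ Set.range I, ∃ a b : Literal B h, C = {a, b} := by
        rintro _ ⟨i, rfl⟩
        obtain ⟨a, b, -, hab⟩ := hP.support _ (hIZ i)
        exact ⟨a, b, hab⟩
      have hcon : ∃ x, Reach (Set.range I) x (neg x) ∧ Reach (Set.range I) (neg x) x := by
        by_contra! hno
        exact hI (exists_assignment_of_no_contradiction hpair fun x hx => hno x hx.1 hx.2)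
      obtain ⟨x, h1, h2⟩ := hcon
      obtain ⟨l, a, b, u, v, hb⟩ := exists_isBicycle h1 h2
      obtain ⟨N, hN, y, j, j', s, s', h1, h2, h3⟩ := hb.exists_fin
      refine Set.mem_biUnion (x := N) (by simpa using hN) ?_
      exact Set.mem_iUnion.2 ⟨(y, (j, s), (j', s')), h1, h2, h3⟩
  have hE : ∀ N (x : ι N), (randomFormula m P).real (E N x) ≤
      (∏ i : Fin N, (m * P.real {({neg (x.1 i.castSucc), x.1 i.succ} : Clause B h)})) *
        κ ^ 2 := by
    intro N x
    by_cases hx : Function.Injective (fun i => (x.1 i).1) ∧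
      ({x.1 0, ((x.1 x.2.1.1).1, x.2.1.2)} : Clause B h) ≠
        {neg (x.1 (Fin.last N)), ((x.1 x.2.2.1).1, x.2.2.2)}
    · refine (measureReal_mono fun I hI => hI.2.2).trans ((prob_contains_le P m _).trans ?_)
      rw [prod_bicycleClauses hx.1 hx.2, mul_comm, sq]
      refine mul_le_mul_of_nonneg_left ?_ (Finset.prod_nonneg fun _ _ => hnn _)
      exact mul_le_mul (hκle _) (hκle _) (hnn _) ((hnn ∅).trans (hκle ∅))
    · have : E N x = ∅ := Set.eq_empty_of_forall_notMem fun I hI => hx ⟨hI.1, hI.2.1⟩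
      rw [this, measureReal_empty]
      exact mul_nonneg (Finset.prod_nonneg fun _ _ => hnn _) (sq_nonneg _)
  have hcol : ∀ b : Literal B h, ∑ a, (m * P.real {({neg a, b} : Clause B h)}) =
      (m : ℝ) / (B * h : ℕ) := by
    intro b
    have hinv : Function.Involutive (neg : Literal B h → Literal B h) := neg_neg
    rw [← Finset.mul_sum]
    have : ∑ a, P.real {({neg a, b} : Clause B h)} = ∑ a, P.real {({b, a} : Clause B h)} := by
      rw [← Equiv.sum_comp hinv.toPerm]
      refine Finset.sum_congr rfl fun a _ => ?_
      rw [Function.Involutive.coe_toPerm, neg_neg, Finset.pair_comm]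
    rw [this, hP.marginal]
    ring
  refine (measureReal_mono hsub).trans ((measureReal_union_le _ _).trans ?_)
  refine le_trans (add_le_of_nonpos_left hZ) ?_
  refine (measureReal_biUnion_finset_le _ _).trans (Finset.sum_le_sum fun N _ => ?_)
  refine (measureReal_iUnion_fintype_le _).trans ((Finset.sum_le_sum fun x _ => hE N x).trans ?_)
  rw [← Finset.sum_mul, Fintype.sum_prod_type]
  simp only [Finset.sum_const, nsmul_eq_mul]
  rw [← Finset.mul_sum, sum_walks hcol N]
  apply le_of_eq
  simp
  ring

/-- Below density one, a random formula is satisfiable with high probability. -/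
theorem tendsto_prob_not_satisfiable_of_lt_one {B : ℕ} (hB : 0 < B) {K : ℝ}
    {P : (h : ℕ) → Measure (Clause B h)} (hP : ∀ h, 2 ≤ h → IsSpreadLaw K (P h))
    {m : ℕ → ℕ} {r : ℝ}
    (hm : Tendsto (fun h => (m h : ℝ) / ((B * h : ℕ) : ℝ)) atTop (𝓝 r)) (hr : r < 1) :
    Tendsto (fun h => (randomFormula (m h) (P h)).real {I | ¬ I.Satisfiable})
      atTop (𝓝 0) := by
  obtain ⟨ρ, hρ, hρ1⟩ := exists_between (max_lt hr one_pos)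
  have hρ0 : 0 < ρ := (le_max_right _ _).trans_lt hρ
  have hn := tendsto_card_var hB
  have hsum : Summable fun N : ℕ => ((N : ℝ) + 1) ^ 2 * ρ ^ N := by
    have h1 := summable_pow_mul_geometric_of_norm_lt_one 2
      (show ‖ρ‖ < 1 by rwa [Real.norm_of_nonneg hρ0.le])
    have h2 := ((summable_nat_add_iff 1).2 h1).mul_left ρ⁻¹
    refine h2.congr fun N => ?_
    push_cast
    rw [pow_succ ρ N, mul_comm (ρ ^ N) ρ, mul_left_comm, inv_mul_cancel_left₀ hρ0.ne']
  set S := ∑' N : ℕ, ((N : ℝ) + 1) ^ 2 * ρ ^ N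
  have hlim : Tendsto (fun h : ℕ => 8 * (ρ * K) ^ 2 * S / ((B * h : ℕ) : ℝ)) atTop (𝓝 0) :=
    hn.const_div_atTop _
  refine tendsto_of_tendsto_of_tendsto_of_le_of_le' tendsto_const_nhds hlim
    (Eventually.of_forall fun _ => measureReal_nonneg) ?_
  filter_upwards [eventually_ge_atTop 2,
    hm.eventually (gt_mem_nhds ((le_max_left _ _).trans_lt hρ))] with h hh hmh
  have hPh := hP h hh
  refine (prob_not_satisfiable_le hPh (m h)).trans ?_
  have hn0 : (0 : ℝ) < ((B * h : ℕ) : ℝ) := by exact_mod_cast Nat.mul_pos hB (by omega)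
  set n : ℝ := ((B * h : ℕ) : ℝ)
  have hKn : 0 ≤ K / n ^ 2 := measureReal_nonneg.trans (hPh.le ∅)
  have hd0 : 0 ≤ (m h : ℝ) / n := by positivity
  have hκ : m h * (K / n ^ 2) ≤ ρ * K / n := by
    have : m h * (K / n ^ 2) = m h / n * (n * (K / n ^ 2)) := by field_simp
    rw [this]
    have e : ρ * K / n = ρ * (n * (K / n ^ 2)) := by field_simp
    rw [e]
    exact mul_le_mul_of_nonneg_right hmh.le (by positivity)
  have hterm : ∀ N : ℕ, (2 * n) * ((m h : ℝ) / n) ^ N *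
      ((2 * ((N : ℝ) + 1)) ^ 2 * (m h * (K / n ^ 2)) ^ 2) ≤
      8 * (ρ * K) ^ 2 / n * (((N : ℝ) + 1) ^ 2 * ρ ^ N) := by
    intro N
    have e1 : ((m h : ℝ) / n) ^ N ≤ ρ ^ N := pow_le_pow_left₀ hd0 hmh.le N
    have e2 : (m h * (K / n ^ 2)) ^ 2 ≤ (ρ * K / n) ^ 2 :=
      pow_le_pow_left₀ (by positivity) hκ 2
    calc _ ≤ (2 * n) * ρ ^ N * ((2 * ((N : ℝ) + 1)) ^ 2 * (ρ * K / n) ^ 2) := by gcongr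
      _ = _ := by field_simp; ring
  refine (Finset.sum_le_sum fun N _ => hterm N).trans ?_
  rw [← Finset.mul_sum]
  have := hsum.sum_le_tsum (Finset.range (B * h)) fun N _ => by positivity
  calc _ ≤ 8 * (ρ * K) ^ 2 / n * S := mul_le_mul_of_nonneg_left this (by positivity)
    _ = _ := by ring

/-! ### Depth-first search for a long implication path -/

/-- The formula has an implication path through at least `k` distinct variables, each edge of which
comes from a clause of positive probability. The list enumerates the path from its end to its
start. -/
def HasLongPath {B h m : ℕ} (P : Measure (Clause B h)) (k : ℕ) (I : Formula B h m) : Prop :=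
  ∃ l : List (Literal B h), k ≤ l.length ∧ (l.map Prod.fst).Nodup ∧
    l.IsChain fun a b => P.real {({neg b, a} : Clause B h)} ≠ 0 ∧ Implies (Set.range I) b a

/-- The state of a depth-first search of the implication digraph: `S` lists the literals whose
out-edges to unvisited variables have all been queried, `U` is the stack (top first), `A` and `D`
are the sets of queried clauses that were found present and absent, respectively. Only clauses of
positive probability need to be queried. A clause found present leads to a new variable, whence the
bound on the number of elements of `A`. -/
structure IsSearchState {B h : ℕ} (P : Measure (Clause B h)) (S U : List (Literal B h))
    (A D : Finset (Clause B h)) : Prop where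
  nodup : ((S ++ U).map Prod.fst).Nodup
  chain : U.IsChain fun a b =>
    P.real {({neg b, a} : Clause B h)} ≠ 0 ∧ ({neg b, a} : Clause B h) ∈ A
  disj : Disjoint A D
  card_le : A.card ≤ (S ++ U).length
  explored : ∀ y ∈ S, ∀ z : Literal B h, z.1 ∉ (S ++ U).map Prod.fst →
    P.real {({neg y, z} : Clause B h)} ≠ 0 → ({neg y, z} : Clause B h) ∈ A ∪ D

/-- A search state with many finished literals has queried clauses of large total probability. -/
lemma IsSearchState.le_sum_queried {B h : ℕ} {K : ℝ} {P : Measure (Clause B h)}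
    (hP : IsSpreadLaw K P) {S U : List (Literal B h)} {A D : Finset (Clause B h)}
    (hs : IsSearchState P S U A D) {k : ℕ} (hk : S.length + U.length = k) :
    (S.length : ℝ) * (1 / ((B * h : ℕ) : ℝ) - 2 * k * (K / ((B * h : ℕ) : ℝ) ^ 2)) ≤
      ∑ C ∈ A, P.real {C} + ∑ C ∈ D, P.real {C} := by
  classical
  set vis := (S ++ U).map Prod.fst with hvis
  rw [← Finset.sum_union hs.disj]
  set R : Finset (Literal B h) := Finset.univ.filter fun z => z.1 ∉ vis with hR
  have hSvis : ∀ y ∈ S, y.1 ∈ vis := fun y hy =>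
    List.mem_map_of_mem (List.mem_append_left _ hy)
  have hnd : S.Nodup := (List.Nodup.of_map _ hs.nodup).of_append_left
  have hK : 0 ≤ K / ((B * h : ℕ) : ℝ) ^ 2 := measureReal_nonneg.trans (hP.le ∅)
  have hrow : ∀ y ∈ S.toFinset, 1 / ((B * h : ℕ) : ℝ) - 2 * k * (K / ((B * h : ℕ) : ℝ) ^ 2) ≤
      ∑ z ∈ R, P.real {({neg y, z} : Clause B h)} := by
    intro y _
    have h1 := hP.marginal (neg y)
    rw [← Finset.sum_filter_add_sum_filter_not Finset.univ (fun z : Literal B h => z.1 ∉ vis)] at h1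
    have hcard : (Finset.univ.filter fun z : Literal B h => ¬ z.1 ∉ vis).card ≤ 2 * k := by
      have : (Finset.univ.filter fun z : Literal B h => ¬ z.1 ∉ vis) ⊆
          vis.toFinset ×ˢ (Finset.univ : Finset Bool) := by
        intro z hz
        simpa using hz
      refine (Finset.card_le_card this).trans ?_
      rw [Finset.card_product]
      have := List.toFinset_card_le vis
      simp [hvis] at this ⊢
      omega
    have h2 : ∑ z ∈ Finset.univ.filter (fun z : Literal B h => ¬ z.1 ∉ vis),
        P.real {({neg y, z} : Clause B h)} ≤ 2 * k * (K / ((B * h : ℕ) : ℝ) ^ 2) := by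
      refine (Finset.sum_le_card_nsmul _ _ _ fun z _ => hP.le _).trans ?_
      rw [nsmul_eq_mul]
      exact mul_le_mul_of_nonneg_right (by exact_mod_cast hcard) hK
    linarith
  calc _ = ∑ y ∈ S.toFinset,
        (1 / ((B * h : ℕ) : ℝ) - 2 * k * (K / ((B * h : ℕ) : ℝ) ^ 2)) := by
        rw [Finset.sum_const, List.toFinset_card_of_nodup hnd, nsmul_eq_mul]
    _ ≤ ∑ y ∈ S.toFinset, ∑ z ∈ R, P.real {({neg y, z} : Clause B h)} := Finset.sum_le_sum hrow
    _ = ∑ x ∈ S.toFinset ×ˢ R, P.real {({neg x.1, x.2} : Clause B h)} := by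
        rw [Finset.sum_product]
    _ = ∑ x ∈ (S.toFinset ×ˢ R).filter fun x => P.real {({neg x.1, x.2} : Clause B h)} ≠ 0,
          P.real {({neg x.1, x.2} : Clause B h)} := (Finset.sum_filter_ne_zero _).symm
    _ = ∑ C ∈ ((S.toFinset ×ˢ R).filter fun x =>
          P.real {({neg x.1, x.2} : Clause B h)} ≠ 0).image
            (fun x => ({neg x.1, x.2} : Clause B h)), P.real {C} := by
        rw [Finset.sum_image]
        rintro ⟨y, z⟩ hyz ⟨y', z'⟩ hyz' heq
        simp only [Finset.coe_filter, Finset.mem_product, List.mem_toFinset, hR,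
          Finset.mem_filter, Finset.mem_univ, true_and, Set.mem_ofPred_eq] at hyz hyz' heq
        have hyv := hSvis y hyz.1.1
        have hyv' := hSvis y' hyz'.1.1
        have e1 : neg y ∈ ({neg y', z'} : Clause B h) := heq ▸ (by simp)
        have e2 : z ∈ ({neg y', z'} : Clause B h) := heq ▸ (by simp)
        simp only [Finset.mem_insert, Finset.mem_singleton] at e1 e2
        rcases e1 with e1 | e1
        · rcases e2 with e2 | e2
          · exact absurd (by rw [e2]; exact hyv') hyz.1.2
          · have : y = y' := by rw [← neg_neg y, e1, neg_neg]
            rw [this, e2]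
        · exact absurd (by rw [← e1]; exact hyv) hyz'.1.2
    _ ≤ ∑ C ∈ A ∪ D, P.real {C} := by
        refine Finset.sum_le_sum_of_subset_of_nonneg ?_ fun _ _ _ => measureReal_nonneg
        intro C hC
        simp only [Finset.mem_image, Finset.mem_filter, Finset.mem_product, List.mem_toFinset, hR,
          Finset.mem_univ, true_and] at hC
        obtain ⟨⟨y, z⟩, ⟨⟨hy, hz⟩, hne⟩, rfl⟩ := hC
        exact hs.explored y hy z hz hne

/-- The potential of the depth-first search: a bound for the probability of the answers
`A`, `D`, times the exponential tilt, with parameters `lam` and `θ`, of the number of positive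
answers and of the total probability of the queried clauses. The tilt is at least one as soon as
there are at most `k` positive answers while the queried clauses have total probability at
least `Q`. -/
noncomputable def searchPotential {B h : ℕ} (P : Measure (Clause B h)) (m k : ℕ)
    (lam θ Q : ℝ) (A D : Finset (Clause B h)) : ℝ :=
  (∏ C ∈ A, (m * P.real {C})) * Real.exp (-((m - k) * ∑ C ∈ D, P.real {C})) *
    Real.exp (lam * (k - A.card) - θ * (Q - ∑ C ∈ A, P.real {C} - ∑ C ∈ D, P.real {C}))

/-- The potential does not increase, on summing over the two answers to a query. -/
lemma searchPotential_insert_add_insert_le {B h : ℕ} (P : Measure (Clause B h)) {m k : ℕ}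
    {lam θ Q : ℝ} {A D : Finset (Clause B h)} {C : Clause B h} (hA : C ∉ A) (hD : C ∉ D)
    (hstep : m * P.real {C} * Real.exp (-lam) + Real.exp (-((m - k) * P.real {C})) ≤
      Real.exp (-(θ * P.real {C}))) :
    searchPotential P m k lam θ Q (insert C A) D + searchPotential P m k lam θ Q A (insert C D) ≤
      searchPotential P m k lam θ Q A D := by
  have h1 : searchPotential P m k lam θ Q (insert C A) D = searchPotential P m k lam θ Q A D *
      Real.exp (θ * P.real {C}) * (m * P.real {C} * Real.exp (-lam)) := by
    unfold searchPotential
    rw [Finset.prod_insert hA, Finset.sum_insert hA, Finset.card_insert_of_notMem hA]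
    push_cast
    rw [show lam * (k - ((A.card : ℝ) + 1)) -
        θ * (Q - (P.real {C} + ∑ C ∈ A, P.real {C}) - ∑ C ∈ D, P.real {C}) =
        (lam * (k - A.card) - θ * (Q - ∑ C ∈ A, P.real {C} - ∑ C ∈ D, P.real {C})) +
        θ * P.real {C} + -lam by ring, Real.exp_add, Real.exp_add]
    ring
  have h2 : searchPotential P m k lam θ Q A (insert C D) = searchPotential P m k lam θ Q A D *
      Real.exp (θ * P.real {C}) * Real.exp (-((m - k) * P.real {C})) := by
    unfold searchPotential
    rw [Finset.sum_insert hD]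
    rw [show lam * (k - (A.card : ℝ)) -
        θ * (Q - ∑ C ∈ A, P.real {C} - (P.real {C} + ∑ C ∈ D, P.real {C})) =
        (lam * (k - A.card) - θ * (Q - ∑ C ∈ A, P.real {C} - ∑ C ∈ D, P.real {C})) +
        θ * P.real {C} by ring, Real.exp_add,
      show -(((m : ℝ) - k) * (P.real {C} + ∑ C ∈ D, P.real {C})) =
        -((m - k) * ∑ C ∈ D, P.real {C}) + -((m - k) * P.real {C}) by ring, Real.exp_add]
    ring
  have h0 : 0 ≤ searchPotential P m k lam θ Q A D * Real.exp (θ * P.real {C}) := by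
    unfold searchPotential
    have : 0 ≤ ∏ C ∈ A, (m * P.real {C}) :=
      Finset.prod_nonneg fun _ _ => mul_nonneg (Nat.cast_nonneg _) measureReal_nonneg
    positivity
  rw [h1, h2, ← mul_add]
  refine (mul_le_mul_of_nonneg_left hstep h0).trans ?_
  rw [mul_assoc, ← Real.exp_add]
  simp

/-- The probability that a formula without long paths gives the answers recorded in a search state
is at most the potential of the state. The search goes on until `k` variables have been visited;
since the stack is a path, at that time almost all visited literals are finished. -/
theorem IsSearchState.prob_le_searchPotential {B h : ℕ} {K : ℝ} {P : Measure (Clause B h)}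
    (hP : IsSpreadLaw K P) {m k ℓ : ℕ} (hkm : k ≤ m) (hkn : k ≤ B * h) {lam θ Q : ℝ}
    (hlam : 0 ≤ lam) (hθ : 0 ≤ θ)
    (hstep : ∀ q : ℝ, 0 ≤ q → q ≤ K / ((B * h : ℕ) : ℝ) ^ 2 →
      m * q * Real.exp (-lam) + Real.exp (-((m - k) * q)) ≤ Real.exp (-(θ * q)))
    (hpos : 0 ≤ 1 / ((B * h : ℕ) : ℝ) - 2 * k * (K / ((B * h : ℕ) : ℝ) ^ 2))
    (hQ : Q ≤ (k - ℓ) * (1 / ((B * h : ℕ) : ℝ) - 2 * k * (K / ((B * h : ℕ) : ℝ) ^ 2)))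
    {S U : List (Literal B h)} {A D : Finset (Clause B h)} (hs : IsSearchState P S U A D)
    (hk : S.length + U.length ≤ k) :
    (randomFormula m P).real {I | ((∀ C ∈ A, C ∈ Set.range I) ∧ ∀ C ∈ D, C ∉ Set.range I) ∧
      ¬ HasLongPath P ℓ I} ≤ searchPotential P m k lam θ Q A D := by
  classical
  have := hP.isProb
  induction hN : 2 * (k - (S.length + U.length)) + U.length + (A ∪ D)ᶜ.card using
    Nat.strong_induction_on generalizing S U A D with
  | _ N ih =>
  rcases hk.eq_or_lt with hk' | hk'
  · by_cases hU : ℓ ≤ U.length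
    · -- the stack is a long path
      have : {I : Formula B h m | ((∀ C ∈ A, C ∈ Set.range I) ∧ ∀ C ∈ D, C ∉ Set.range I) ∧
          ¬ HasLongPath P ℓ I} = ∅ := by
        refine Set.eq_empty_of_forall_notMem ?_
        rintro I ⟨⟨hA, -⟩, hI⟩
        refine hI ⟨U, hU, ?_, hs.chain.imp fun a b hab => ⟨hab.1, hA _ hab.2⟩⟩
        have := hs.nodup
        rw [List.map_append] at this
        exact this.of_append_right
      rw [this]
      unfold searchPotential
      have : 0 ≤ ∏ C ∈ A, (m * P.real {C}) :=
        Finset.prod_nonneg fun _ _ => mul_nonneg (Nat.cast_nonneg _) measureReal_nonneg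
      simp only [measureReal_empty]
      positivity
    · have hA : A.card ≤ k := by simpa [hk'] using hs.card_le
      refine (measureReal_mono fun I hI => hI.1).trans
        ((prob_contains_avoids_le_exp P A D hA hkm).trans ?_)
      unfold searchPotential
      refine le_mul_of_one_le_right (mul_nonneg (Finset.prod_nonneg fun _ _ =>
        mul_nonneg (Nat.cast_nonneg _) measureReal_nonneg) (Real.exp_nonneg _)) ?_
      rw [Real.one_le_exp_iff]
      have h1 := hs.le_sum_queried hP hk'
      have h2 : ((k : ℝ) - ℓ) ≤ S.length := by
        have : (k : ℝ) = S.length + U.length := by exact_mod_cast hk'.symm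
        have : (U.length : ℝ) ≤ ℓ := by exact_mod_cast (not_le.1 hU).le
        linarith
      have h3 := mul_le_mul_of_nonneg_right h2 hpos
      have h4 : 0 ≤ lam * (k - A.card) :=
        mul_nonneg hlam (sub_nonneg.2 (by exact_mod_cast hA))
      have h5 : θ * (Q - ∑ C ∈ A, P.real {C} - ∑ C ∈ D, P.real {C}) ≤ 0 :=
        mul_nonpos_of_nonneg_of_nonpos hθ (by linarith)
      linarith
  -- a variable that is still unvisited
  obtain ⟨v, hv⟩ : ∃ v, v ∉ (S ++ U).map Prod.fst := by
    by_contra! hall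
    have h1 : (Finset.univ : Finset (Var B h)) ⊆ ((S ++ U).map Prod.fst).toFinset :=
      fun v _ => List.mem_toFinset.2 (hall v)
    have h2 := (Finset.card_le_card h1).trans (List.toFinset_card_le _)
    simp at h2
    omega
  have hpush : ∀ z : Literal B h, z.1 ∉ (S ++ U).map Prod.fst →
      ((S ++ z :: U).map Prod.fst).Nodup := by
    intro z hz
    have := hs.nodup
    rw [List.map_append] at this hz
    rw [List.map_append, List.map_cons, List.nodup_middle]
    exact List.nodup_cons.2 ⟨hz, this⟩
  have hvis : ∀ z w : Literal B h, w.1 ∉ (S ++ z :: U).map Prod.fst →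
      w.1 ∉ (S ++ U).map Prod.fst := by
    intro z w hw hw'
    simp only [List.map_append, List.map_cons, List.mem_append, List.mem_cons] at hw hw'
    tauto
  -- On an empty stack, start from a new variable; otherwise query an out-edge of the top, or pop.
  match U, hs, hk, hk', hN, hv, hpush, hvis with
  | [], hs, hk, hk', hN, hv, hpush, hvis =>
    refine ih _ ?_ (S := S) (U := [(v, true)]) (A := A) (D := D) ⟨hpush (v, true) hv, by simp,
      hs.disj, ?_, fun y hy z hz => hs.explored y hy z (hvis _ z hz)⟩ ?_ rfl
    · simp at hN hk' ⊢; omega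
    · have := hs.card_le; simp at this ⊢; omega
    · simp at hk' ⊢; omega
  | y :: U, hs, hk, hk', hN, hv, hpush, hvis =>
    by_cases hz : ∃ z : Literal B h, z.1 ∉ (S ++ y :: U).map Prod.fst ∧
        P.real {({neg y, z} : Clause B h)} ≠ 0 ∧ ({neg y, z} : Clause B h) ∉ A ∪ D
    · obtain ⟨z, hz, hq, hC⟩ := hz
      have hC' := hC
      rw [Finset.mem_union, not_or] at hC'
      have hcard : (insert ({neg y, z} : Clause B h) (A ∪ D))ᶜ.card < (A ∪ D)ᶜ.card := by
        refine Finset.card_lt_card ⟨Finset.compl_subset_compl.2 (Finset.subset_insert _ _), ?_⟩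
        intro hsub
        have := hsub (Finset.mem_compl.2 hC)
        simp at this
      have hs1 : IsSearchState P S (z :: y :: U) (insert {neg y, z} A) D := by
        refine ⟨hpush z hz, ?_, ?_, ?_, ?_⟩
        · rw [List.isChain_cons_cons]
          exact ⟨⟨hq, Finset.mem_insert_self _ _⟩,
            hs.chain.imp fun a b hab => ⟨hab.1, Finset.mem_insert_of_mem hab.2⟩⟩
        · exact Finset.disjoint_insert_left.2 ⟨hC'.2, hs.disj⟩
        · have := hs.card_le
          rw [Finset.card_insert_of_notMem hC'.1]
          simp at this ⊢
          omega
        · intro w hw x hx hne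
          rw [Finset.insert_union]
          exact Finset.mem_insert_of_mem (hs.explored w hw x (hvis _ x hx) hne)
      have hs2 : IsSearchState P S (y :: U) A (insert {neg y, z} D) := by
        refine ⟨hs.nodup, hs.chain, Finset.disjoint_insert_right.2 ⟨hC'.1, hs.disj⟩,
          hs.card_le, ?_⟩
        intro w hw x hx hne
        rw [Finset.union_insert]
        exact Finset.mem_insert_of_mem (hs.explored w hw x hx hne)
      have i1 := ih _ (by
        rw [Finset.insert_union]
        simp only [List.length_cons] at hN hk' ⊢; omega) hs1 (by simp at hk' ⊢; omega) rfl
      have i2 := ih _ (by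
        rw [Finset.union_insert]
        simp only [List.length_cons] at hN hk' ⊢; omega) hs2 hk rfl
      refine le_trans ?_ (searchPotential_insert_add_insert_le P hC'.1 hC'.2
        (hstep _ measureReal_nonneg (hP.le _)))
      refine le_trans ?_ (add_le_add i1 i2)
      refine (measureReal_mono ?_).trans (measureReal_union_le _ _)
      rintro I ⟨⟨hA, hD⟩, hI⟩
      by_cases hmem : ({neg y, z} : Clause B h) ∈ Set.range I
      · exact .inl ⟨⟨Finset.forall_mem_insert _ _ _ |>.2 ⟨hmem, hA⟩, hD⟩, hI⟩
      · exact .inr ⟨⟨hA, Finset.forall_mem_insert _ _ _ |>.2 ⟨hmem, hD⟩⟩, hI⟩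
    · -- the top of the stack is finished
      push Not at hz
      have hl : (S ++ [y]) ++ U = S ++ y :: U := by simp
      refine ih _ ?_ (S := S ++ [y]) (U := U) ⟨by rw [hl]; exact hs.nodup, hs.chain.of_cons,
        hs.disj, by rw [hl]; exact hs.card_le, ?_⟩ ?_ rfl
      · simp at hN hk' ⊢; omega
      · rw [hl]
        intro w hw x hx hne
        rcases List.mem_append.1 hw with hw | hw
        · exact hs.explored w hw x hx hne
        · obtain rfl := List.mem_singleton.1 hw
          exact hz x hx hne
      · simp at hk' ⊢; omega

theorem prob_not_hasLongPath_le {B h : ℕ} {K : ℝ} {P : Measure (Clause B h)}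
    (hP : IsSpreadLaw K P) {m k ℓ : ℕ} (hkm : k ≤ m) (hkn : k ≤ B * h) {lam θ Q : ℝ}
    (hlam : 0 ≤ lam) (hθ : 0 ≤ θ)
    (hstep : ∀ q : ℝ, 0 ≤ q → q ≤ K / ((B * h : ℕ) : ℝ) ^ 2 →
      m * q * Real.exp (-lam) + Real.exp (-((m - k) * q)) ≤ Real.exp (-(θ * q)))
    (hpos : 0 ≤ 1 / ((B * h : ℕ) : ℝ) - 2 * k * (K / ((B * h : ℕ) : ℝ) ^ 2))
    (hQ : Q ≤ (k - ℓ) * (1 / ((B * h : ℕ) : ℝ) - 2 * k * (K / ((B * h : ℕ) : ℝ) ^ 2))) :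
    (randomFormula m P).real {I | ¬ HasLongPath P ℓ I} ≤ Real.exp (lam * k - θ * Q) := by
  have hs : IsSearchState P [] [] ∅ ∅ := by constructor <;> simp
  simpa [searchPotential] using
    hs.prob_le_searchPotential hP hkm hkn hlam hθ hstep hpos hQ (by simp)

/-! ### Contradicting a long path -/

/-- A path in the implication digraph is contradicted by a clause inside its initial part `l₁`
together with a clause inside the negation of its final part `l₂`: the former makes some literal of
`l₁` true, hence all of `l₂`. -/
lemma not_satisfiable_of_path {V : Type*} [DecidableEq V] {F : Set (Finset (V × Bool))}
    {l₁ l₂ : List (V × Bool)} (hch : (l₂ ++ l₁).IsChain fun a b => Implies F b a)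
    {C₁ C₂ : Finset (V × Bool)} (hC₁ : C₁ ∈ F) (hC₂ : C₂ ∈ F) (h₁ : ∀ x ∈ C₁, x ∈ l₁)
    (h₂ : ∀ x ∈ C₂, neg x ∈ l₂) : ¬ ∃ σ : V → Bool, ∀ C ∈ F, ∃ l ∈ C, σ l.1 = l.2 := by
  rintro ⟨σ, hσ⟩
  have hch' : (l₂ ++ l₁).IsChain fun a b => σ b.1 = b.2 → σ a.1 = a.2 := by
    refine hch.imp fun a b hab hb => ?_
    obtain ⟨l, hl, hl'⟩ := hσ _ hab
    rcases Finset.mem_insert.1 hl with rfl | hl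
    · simp [neg, hb] at hl'
    · rwa [Finset.mem_singleton.1 hl] at hl'
  have : IsTrans (V × Bool) fun a b => σ b.1 = b.2 → σ a.1 = a.2 :=
    ⟨fun a b c hab hbc hc => hab (hbc hc)⟩
  have hpw := List.isChain_iff_pairwise.1 hch'
  obtain ⟨x, hx, hx'⟩ := hσ _ hC₁
  obtain ⟨y, hy, hy'⟩ := hσ _ hC₂
  have := (List.pairwise_append.1 hpw).2.2 _ (h₂ y hy) _ (h₁ x hx) hx'
  simp [neg, hy'] at this

/-- Two independent random formulas, one after the other, form a random formula. -/
lemma measurePreserving_append {B h : ℕ} (P : Measure (Clause B h)) [IsProbabilityMeasure P]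
    (m₁ m₂ : ℕ) : MeasurePreserving
      (fun x : Formula B h m₁ × Formula B h m₂ => (Fin.append x.1 x.2 : Formula B h (m₁ + m₂)))
      ((randomFormula m₁ P).prod (randomFormula m₂ P)) (randomFormula (m₁ + m₂) P) := by
  refine ⟨measurable_of_countable _, ?_⟩
  refine Eq.symm (Measure.pi_eq fun s hs => ?_)
  rw [Measure.map_apply (measurable_of_countable _) (MeasurableSet.univ_pi hs)]
  have : (fun x : Formula B h m₁ × Formula B h m₂ => (Fin.append x.1 x.2 : Formula B h (m₁ + m₂)))
      ⁻¹' Set.pi Set.univ s =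
      (Set.pi Set.univ fun i => s (Fin.castAdd m₂ i)) ×ˢ
        (Set.pi Set.univ fun i => s (Fin.natAdd m₁ i)) := by
    ext x
    simp only [Set.mem_preimage, Set.mem_pi, Set.mem_univ, true_imp_iff, Set.mem_prod]
    refine ⟨fun H => ⟨fun i => ?_, fun i => ?_⟩, fun H i => ?_⟩
    · simpa using H (Fin.castAdd m₂ i)
    · simpa using H (Fin.natAdd m₁ i)
    · induction i using Fin.addCases with
      | left i => simpa using H.1 i
      | right i => simpa using H.2 i
  rw [this, Measure.prod_prod, Fin.prod_univ_add]
  simp [randomFormula, Measure.pi_pi]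

lemma prob_forall_not_le {B h : ℕ} (P : Measure (Clause B h)) [IsProbabilityMeasure P] (m : ℕ)
    {c : ℝ} (s : Set (Clause B h)) (hc : c ≤ P.real s) :
    (randomFormula m P).real {J | ∀ i, J i ∉ s} ≤ (1 - c) ^ m := by
  have : {J : Formula B h m | ∀ i, J i ∉ s} = Set.pi Set.univ fun _ => sᶜ := by
    ext; simp
  rw [this]
  have h1 : (randomFormula m P).real (Set.pi Set.univ fun _ => sᶜ) = P.real sᶜ ^ m := by
    simp [Measure.real, randomFormula, Measure.pi_pi]
  rw [h1]
  refine pow_le_pow_left₀ measureReal_nonneg ?_ m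
  rw [probReal_compl_eq_one_sub s.toFinite.measurableSet]
  linarith

/-- If long paths are likely in a formula with `m₁` clauses, and each path of length `j` contains a
random clause with probability at least `c`, and so does its negation, then `m₂` further clauses
likely contradict a path of length `2 * j`. -/
theorem prob_satisfiable_add_le {B h : ℕ} (P : Measure (Clause B h)) [IsProbabilityMeasure P]
    {c : ℝ} {j : ℕ} (hc1 : c ≤ 1)
    (hhit : ∀ l : List (Literal B h), j ≤ l.length → (l.map Prod.fst).Nodup →
      l.IsChain (fun a b => P.real {({neg b, a} : Clause B h)} ≠ 0) →
      c ≤ P.real {C | ∀ x ∈ C, x ∈ l} ∧ c ≤ P.real {C | ∀ x ∈ C, neg x ∈ l}) (m₁ m₂ : ℕ) :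
    (randomFormula (m₁ + m₂) P).real {I | I.Satisfiable} ≤
      (randomFormula m₁ P).real {I | ¬ HasLongPath P (2 * j) I} + 2 * (1 - c) ^ m₂ := by
  classical
  have hslice : ∀ I : Formula B h m₁, HasLongPath P (2 * j) I →
      (randomFormula m₂ P).real {J | Formula.Satisfiable (Fin.append I J : Formula B h (m₁ + m₂))} ≤
        2 * (1 - c) ^ m₂ := by
    rintro I ⟨l, hl, hnd, hch⟩
    -- The list runs from the end of the path to its start.
    have hl' : l.take j ++ l.drop j = l := List.take_append_drop j l
    rw [← hl'] at hnd hch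
    rw [List.map_append] at hnd
    have hch' := List.isChain_append.1 hch
    have h1 := (hhit (l.drop j) (by rw [List.length_drop]; omega) hnd.of_append_right
      (hch'.2.1.imp fun a b hab => hab.1)).1
    have h2 := (hhit (l.take j) (by rw [List.length_take]; omega) hnd.of_append_left
      (hch'.1.imp fun a b hab => hab.1)).2
    have hsub : {J : Formula B h m₂ |
        Formula.Satisfiable (Fin.append I J : Formula B h (m₁ + m₂))} ⊆
        {J | ∀ i, J i ∉ {C : Clause B h | ∀ x ∈ C, x ∈ l.drop j}} ∪
        {J | ∀ i, J i ∉ {C : Clause B h | ∀ x ∈ C, neg x ∈ l.take j}} := by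
      intro J hJ
      by_contra hcon
      simp only [Set.mem_union, Set.mem_ofPred_eq, not_or, not_forall] at hcon
      obtain ⟨⟨i₁, hi₁⟩, i₂, hi₂⟩ := hcon
      rw [Set.mem_ofPred_eq, satisfiable_iff] at hJ
      refine not_satisfiable_of_path
        (F := Set.range (Fin.append I J : Formula B h (m₁ + m₂))) (l₁ := l.drop j) (l₂ := l.take j)
        (hch.imp fun a b hab => ?_) (C₁ := J i₁) (C₂ := J i₂) ⟨Fin.natAdd m₁ i₁, by simp⟩
        ⟨Fin.natAdd m₁ i₂, by simp⟩ (by simpa using hi₁) (by simpa using hi₂) hJ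
      obtain ⟨i, hi⟩ := hab.2
      exact ⟨Fin.castAdd m₂ i, by simpa using hi⟩
    refine (measureReal_mono hsub).trans ((measureReal_union_le _ _).trans ?_)
    have := prob_forall_not_le P m₂ _ h1
    have := prob_forall_not_le P m₂ _ h2
    linarith
  rw [← (measurePreserving_append P m₁ m₂).measureReal_preimage
    (Set.toFinite _).measurableSet.nullMeasurableSet]
  set T : Set (Formula B h m₁ × Formula B h m₂) :=
    {x | HasLongPath P (2 * j) x.1 ∧ Formula.Satisfiable (Fin.append x.1 x.2)} with hT
  have hTle : ((randomFormula m₁ P).prod (randomFormula m₂ P)).real T ≤ 2 * (1 - c) ^ m₂ := by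
    have h0 : 0 ≤ 2 * (1 - c) ^ m₂ := by
      have : 0 ≤ 1 - c := by linarith
      positivity
    refine ENNReal.toReal_le_of_le_ofReal h0 ?_
    rw [Measure.prod_apply (Set.toFinite _).measurableSet]
    calc _ ≤ ∫⁻ _ : Formula B h m₁, ENNReal.ofReal (2 * (1 - c) ^ m₂) ∂(randomFormula m₁ P) := by
          refine lintegral_mono fun I => ?_
          by_cases hI : HasLongPath P (2 * j) I
          · rw [← ofReal_measureReal]
            refine ENNReal.ofReal_le_ofReal (le_trans (measureReal_mono ?_) (hslice I hI))
            intro J hJ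
            exact hJ.2
          · have : Prod.mk I ⁻¹' T = ∅ :=
              Set.eq_empty_of_forall_notMem fun J hJ => hI hJ.1
            rw [this]; simp
      _ = _ := by simp
  calc _ ≤ ((randomFormula m₁ P).prod (randomFormula m₂ P)).real
        ({I | ¬ HasLongPath P (2 * j) I} ×ˢ Set.univ ∪ T) := by
        refine measureReal_mono ?_
        intro x hx
        by_cases hI : HasLongPath P (2 * j) x.1
        · exact .inr ⟨hI, hx⟩
        · exact .inl ⟨hI, trivial⟩
    _ ≤ _ := (measureReal_union_le _ _).trans (by
        refine add_le_add (le_of_eq ?_) hTle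
        rw [measureReal_prod_prod]; simp)

/-- Each clause is counted at most twice among the pairs of literals of `L`. -/
lemma sum_pairs_le {B h : ℕ} (P : Measure (Clause B h)) [IsProbabilityMeasure P]
    (L : Finset (Literal B h)) :
    ∑ a ∈ L, ∑ b ∈ L, P.real {({a, b} : Clause B h)} ≤ 2 * P.real {C | ∀ x ∈ C, x ∈ L} := by
  classical
  rw [measureReal_eq_sum_filter, ← Finset.sum_product', Finset.mul_sum]
  rw [← Finset.sum_fiberwise_of_maps_to (s := L ×ˢ L)
    (t := Finset.univ.filter fun C : Clause B h => ∀ x ∈ C, x ∈ L)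
    (g := fun x : Literal B h × Literal B h => ({x.1, x.2} : Clause B h))]
  · refine Finset.sum_le_sum fun C _ => ?_
    rw [Finset.sum_congr rfl (g := fun _ => P.real {C})
      (fun x hx => by rw [(Finset.mem_filter.1 hx).2]), Finset.sum_const, nsmul_eq_mul]
    refine mul_le_mul_of_nonneg_right ?_ measureReal_nonneg
    by_cases hC : ∃ a b : Literal B h, C = {a, b}
    · obtain ⟨a, b, rfl⟩ := hC
      have : ((L ×ˢ L).filter fun x : Literal B h × Literal B h =>
          ({x.1, x.2} : Clause B h) = {a, b}) ⊆ {(a, b), (b, a)} := by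
        rintro ⟨x, y⟩ hx
        have := pair_eq_pair_iff.1 (Finset.mem_filter.1 hx).2
        simpa using this
      have := (Finset.card_le_card this).trans Finset.card_le_two
      exact_mod_cast this
    · rw [Finset.filter_eq_empty_iff.2]
      · simp
      · intro x _ hx
        exact hC ⟨_, _, hx.symm⟩
  · intro x hx
    rw [Finset.mem_product] at hx
    refine Finset.mem_filter.2 ⟨Finset.mem_univ _, fun y hy => ?_⟩
    rcases Finset.mem_insert.1 hy with rfl | hy
    · exact hx.1
    · rw [Finset.mem_singleton.1 hy]; exact hx.2

/-! ### The mixture of the two uniform clause laws -/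

lemma mem_clausesOfType_one_one {B h : ℕ} {C : Clause B h} :
    C ∈ clausesOfType B h [1, 1] ↔ ∃ a b : Literal B h, a.1.1 ≠ b.1.1 ∧ C = {a, b} := by
  constructor
  · rintro ⟨-, hcard, i, hi⟩
    have h0 := hi 0
    have h1 := hi 1
    simp at h0 h1 hcard
    rw [Finset.card_eq_one] at h0 h1
    obtain ⟨a, ha⟩ := h0
    obtain ⟨b, hb⟩ := h1
    have ha' : a ∈ C ∧ a.1.1 = i 0 := by
      have : a ∈ C.filter fun l => l.1.1 = i 0 := by rw [ha]; simp
      simpa using this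
    have hb' : b ∈ C ∧ b.1.1 = i 1 := by
      have : b ∈ C.filter fun l => l.1.1 = i 1 := by rw [hb]; simp
      simpa using this
    have hne : a.1.1 ≠ b.1.1 := by
      rw [ha'.2, hb'.2]
      exact fun h => absurd (i.injective h) (by simp)
    refine ⟨a, b, hne, ?_⟩
    refine (Finset.eq_of_subset_of_card_le ?_ ?_).symm
    · intro x hx
      rcases Finset.mem_insert.1 hx with rfl | hx
      · exact ha'.1
      · rw [Finset.mem_singleton.1 hx]; exact hb'.1
    · rw [Finset.card_pair (fun h => hne (by rw [h]))]; omega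
  · rintro ⟨a, b, hne, rfl⟩
    refine ⟨?_, ?_, ⟨![a.1.1, b.1.1], ?_⟩, ?_⟩
    · intro l hl l' hl' heq
      simp only [Finset.mem_insert, Finset.mem_singleton] at hl hl'
      rcases hl with rfl | rfl <;> rcases hl' with rfl | rfl <;> simp_all
    · rw [Finset.card_pair (fun h => hne (by rw [h]))]; simp
    · intro x y hxy
      fin_cases x <;> fin_cases y <;> simp_all
    · have hf : ∀ c d : Literal B h, c.1.1 ≠ d.1.1 →
          (({c, d} : Clause B h).filter fun l => l.1.1 = c.1.1).card = 1 := by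
        intro c d hcd
        refine Finset.card_eq_one.2 ⟨c, ?_⟩
        ext x
        simp only [Finset.mem_filter, Finset.mem_insert, Finset.mem_singleton]
        grind
      intro x
      fin_cases x
      · exact hf a b hne
      · rw [Finset.pair_comm]
        exact hf b a hne.symm

lemma mem_clausesOfType_two {B h : ℕ} {C : Clause B h} :
    C ∈ clausesOfType B h [2] ↔
      ∃ a b : Literal B h, (a.1 ≠ b.1 ∧ a.1.1 = b.1.1) ∧ C = {a, b} := by
  constructor
  · rintro ⟨hvar, hcard, i, hi⟩
    have h0 := hi 0
    simp at h0 hcard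
    obtain ⟨a, b, hab, rfl⟩ := Finset.card_eq_two.1 hcard
    have hall := Finset.filter_card_eq (h0.trans hcard.symm)
    refine ⟨a, b, ⟨fun h => hab (hvar a (by simp) b (by simp) h), ?_⟩, rfl⟩
    rw [hall a (by simp), hall b (by simp)]
  · rintro ⟨a, b, ⟨hne, hc⟩, rfl⟩
    have hab : a ≠ b := fun h => hne (by rw [h])
    refine ⟨?_, ?_, ⟨![a.1.1], ?_⟩, ?_⟩
    · intro l hl l' hl' heq
      simp only [Finset.mem_insert, Finset.mem_singleton] at hl hl'
      rcases hl with rfl | rfl <;> rcases hl' with rfl | rfl <;> simp_all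
    · rw [Finset.card_pair hab]; simp
    · intro x y hxy
      exact Subsingleton.elim (α := Fin 1) x y
    · intro x
      fin_cases x
      simp [Finset.filter_insert, Finset.filter_singleton, hc, Finset.card_pair hab]

/-- A set of clauses `{a, b}`, given by a symmetric relation in which each literal has `d` partners,
has `n * d` elements, by double counting. -/
lemma ncard_of_regular {B h : ℕ} {T : Set (Clause B h)} {R : Literal B h → Literal B h → Prop}
    [DecidableRel R] (hsymm : ∀ a b, R a b → R b a) (hne : ∀ a b, R a b → a.1 ≠ b.1)
    (hT : ∀ C, C ∈ T ↔ ∃ a b, R a b ∧ C = {a, b}) {d : ℕ}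
    (hd : ∀ a, (Finset.univ.filter fun b => R a b).card = d) : T.ncard = B * h * d := by
  classical
  have h1 : (Finset.univ.filter fun x : Literal B h × Literal B h => R x.1 x.2).card =
      2 * (B * h) * d := by
    rw [← Finset.univ_product_univ, Finset.card_filter, Finset.sum_product]
    simp_rw [← Finset.card_filter, hd]
    simp [mul_comm]
  have h2 : (Finset.univ.filter fun x : Literal B h × Literal B h => R x.1 x.2).card =
      2 * T.ncard := by
    rw [Set.ncard_eq_toFinset_card', Finset.card_eq_sum_card_fiberwise
      (f := fun x : Literal B h × Literal B h => ({x.1, x.2} : Clause B h)) (t := T.toFinset),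
      Finset.sum_const_nat (m := 2), mul_comm]
    · intro C hC
      rw [Set.mem_toFinset, hT] at hC
      obtain ⟨a, b, hab, rfl⟩ := hC
      have : ((Finset.univ.filter fun x : Literal B h × Literal B h => R x.1 x.2).filter
          fun x => ({x.1, x.2} : Clause B h) = {a, b}) = {(a, b), (b, a)} := by
        ext ⟨x, y⟩
        simp only [Finset.mem_filter, Finset.mem_univ, true_and, pair_eq_pair_iff,
          Finset.mem_insert, Finset.mem_singleton, Prod.mk.injEq]
        constructor
        · exact fun h => h.2
        · rintro (⟨rfl, rfl⟩ | ⟨rfl, rfl⟩)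
          · exact ⟨hab, .inl ⟨rfl, rfl⟩⟩
          · exact ⟨hsymm _ _ hab, .inr ⟨rfl, rfl⟩⟩
      rw [this, Finset.card_pair]
      intro h
      exact hne a b hab (by rw [(Prod.mk.inj h).1])
    · intro x hx
      have := (Finset.mem_filter.1 hx).2
      rw [Finset.mem_coe, Set.mem_toFinset, hT]
      exact ⟨_, _, this, rfl⟩
  have := h1.symm.trans h2
  nlinarith

lemma uniformOn_real_singleton {B h : ℕ} (T : Set (Clause B h)) [DecidablePred (· ∈ T)]
    (C : Clause B h) :
    (ProbabilityTheory.uniformOn T).real {C} = if C ∈ T then (1 : ℝ) / T.ncard else 0 := by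
  classical
  have hT := T.toFinite
  rw [Measure.real, ProbabilityTheory.uniformOn, ProbabilityTheory.cond_apply hT.measurableSet]
  rw [Measure.count_apply_finite _ hT, Set.ncard_eq_toFinset_card T hT]
  split_ifs with hC
  · rw [Set.inter_eq_self_of_subset_right (Set.singleton_subset_iff.2 hC)]
    simp
  · rw [Set.inter_singleton_eq_empty.2 hC]
    simp

/-- The probability of `{a, b}` under the uniform law on a regular family of two-clauses. -/
lemma uniformOn_real_pair {B h : ℕ} {T : Set (Clause B h)} {R : Literal B h → Literal B h → Prop}
    [DecidableRel R] (hsymm : ∀ a b, R a b → R b a) (hne : ∀ a b, R a b → a.1 ≠ b.1)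
    (hT : ∀ C, C ∈ T ↔ ∃ a b, R a b ∧ C = {a, b}) {d : ℕ}
    (hd : ∀ a, (Finset.univ.filter fun b => R a b).card = d) (a b : Literal B h) :
    (ProbabilityTheory.uniformOn T).real {({a, b} : Clause B h)} =
      if R a b then 1 / (((B * h : ℕ) : ℝ) * d) else 0 := by
  classical
  rw [uniformOn_real_singleton, ncard_of_regular hsymm hne hT hd]
  have : ({a, b} : Clause B h) ∈ T ↔ R a b := by
    rw [hT]
    constructor
    · rintro ⟨x, y, hxy, heq⟩
      rcases pair_eq_pair_iff.1 heq with ⟨rfl, rfl⟩ | ⟨rfl, rfl⟩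
      · exact hxy
      · exact hsymm _ _ hxy
    · exact fun hab => ⟨a, b, hab, rfl⟩
  simp only [this]
  push_cast
  rfl

lemma card_filter_community_ne {B h : ℕ} (a : Literal B h) :
    (Finset.univ.filter fun b : Literal B h => a.1.1 ≠ b.1.1).card = 2 * ((B - 1) * h) := by
  have : (Finset.univ.filter fun b : Literal B h => a.1.1 ≠ b.1.1) =
      ((Finset.univ.erase a.1.1 ×ˢ (Finset.univ : Finset (Fin h))) ×ˢ
        (Finset.univ : Finset Bool)) := by
    ext b
    simp only [Finset.mem_filter, Finset.mem_univ, true_and, Finset.mem_product, Finset.mem_erase,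
      and_true]
    exact ne_comm
  rw [this]
  simp [mul_comm]

lemma card_filter_community_eq {B h : ℕ} (a : Literal B h) :
    (Finset.univ.filter fun b : Literal B h => a.1 ≠ b.1 ∧ a.1.1 = b.1.1).card =
      2 * (h - 1) := by
  have : (Finset.univ.filter fun b : Literal B h => a.1 ≠ b.1 ∧ a.1.1 = b.1.1) =
      (({a.1.1} ×ˢ (Finset.univ.erase a.1.2)) ×ˢ (Finset.univ : Finset Bool)) := by
    ext ⟨⟨i, x⟩, s⟩
    obtain ⟨⟨i', x'⟩, s'⟩ := a
    simp [Prod.ext_iff]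
    grind
  rw [this]
  simp [mul_comm]

lemma typeMeasure_one_one_pair {B h : ℕ} (a b : Literal B h) :
    (typeMeasure B h [1, 1]).real {({a, b} : Clause B h)} =
      if a.1.1 ≠ b.1.1 then 1 / (((B * h : ℕ) : ℝ) * (2 * ((B - 1) * h) : ℕ)) else 0 :=
  uniformOn_real_pair (R := fun a b : Literal B h => a.1.1 ≠ b.1.1) (fun _ _ h => h.symm)
    (fun _ _ h h' => h (by rw [h'])) (fun _ => mem_clausesOfType_one_one)
    card_filter_community_ne a b

lemma typeMeasure_two_pair {B h : ℕ} (a b : Literal B h) :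
    (typeMeasure B h [2]).real {({a, b} : Clause B h)} =
      if a.1 ≠ b.1 ∧ a.1.1 = b.1.1 then 1 / (((B * h : ℕ) : ℝ) * (2 * (h - 1) : ℕ)) else 0 :=
  uniformOn_real_pair (R := fun a b : Literal B h => a.1 ≠ b.1 ∧ a.1.1 = b.1.1)
    (fun _ _ h => ⟨h.1.symm, h.2.symm⟩) (fun _ _ h => h.1) (fun _ => mem_clausesOfType_two)
    card_filter_community_eq a b

lemma isProbabilityMeasure_one_one {B h : ℕ} (hB : 2 ≤ B) (hh : 2 ≤ h) :
    IsProbabilityMeasure (typeMeasure B h [1, 1]) := by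
  refine ProbabilityTheory.isProbabilityMeasure_uniformOn (Set.toFinite _) ?_
  refine ⟨_, mem_clausesOfType_one_one.2
    ⟨((⟨0, by omega⟩, ⟨0, by omega⟩), true), ((⟨1, by omega⟩, ⟨0, by omega⟩), true), ?_, rfl⟩⟩
  simp

lemma isProbabilityMeasure_two {B h : ℕ} (hB : 2 ≤ B) (hh : 2 ≤ h) :
    IsProbabilityMeasure (typeMeasure B h [2]) := by
  refine ProbabilityTheory.isProbabilityMeasure_uniformOn (Set.toFinite _) ?_
  refine ⟨_, mem_clausesOfType_two.2
    ⟨((⟨0, by omega⟩, ⟨0, by omega⟩), true), ((⟨0, by omega⟩, ⟨1, by omega⟩), true), ?_, rfl⟩⟩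
  simp

lemma isProbabilityMeasure_mixedMeasure {p : ℝ} (hp0 : 0 ≤ p) (hp1 : p ≤ 1) {B h : ℕ}
    (hB : 2 ≤ B) (hh : 2 ≤ h) : IsProbabilityMeasure (mixedMeasure p B h) := by
  have := isProbabilityMeasure_one_one hB hh
  have := isProbabilityMeasure_two hB hh
  constructor
  simp only [mixedMeasure, Measure.add_apply, Measure.smul_apply, measure_univ, smul_eq_mul,
    mul_one]
  rw [← ENNReal.ofReal_add hp0 (by linarith)]
  simp

lemma mixedMeasure_real {p : ℝ} (hp0 : 0 ≤ p) (hp1 : p ≤ 1) {B h : ℕ} (hB : 2 ≤ B) (hh : 2 ≤ h)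
    (s : Set (Clause B h)) : (mixedMeasure p B h).real s =
      p * (typeMeasure B h [1, 1]).real s + (1 - p) * (typeMeasure B h [2]).real s := by
  have := isProbabilityMeasure_one_one hB hh
  have := isProbabilityMeasure_two hB hh
  rw [mixedMeasure, measureReal_add_apply (by simp [ENNReal.mul_ne_top])
    (by simp [ENNReal.mul_ne_top])]
  simp [ENNReal.toReal_ofReal hp0, ENNReal.toReal_ofReal (sub_nonneg.2 hp1)]

lemma mixedMeasure_pair {p : ℝ} (hp0 : 0 ≤ p) (hp1 : p ≤ 1) {B h : ℕ} (hB : 2 ≤ B) (hh : 2 ≤ h)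
    (a b : Literal B h) : (mixedMeasure p B h).real {({a, b} : Clause B h)} =
      p * (if a.1.1 ≠ b.1.1 then 1 / (((B * h : ℕ) : ℝ) * (2 * ((B - 1) * h) : ℕ)) else 0) +
      (1 - p) * (if a.1 ≠ b.1 ∧ a.1.1 = b.1.1 then
        1 / (((B * h : ℕ) : ℝ) * (2 * (h - 1) : ℕ)) else 0) := by
  rw [mixedMeasure_real hp0 hp1 hB hh, typeMeasure_one_one_pair, typeMeasure_two_pair]

theorem isSpreadLaw_mixedMeasure {p : ℝ} (hp0 : 0 ≤ p) (hp1 : p ≤ 1) {B h : ℕ} (hB : 2 ≤ B)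
    (hh : 2 ≤ h) : IsSpreadLaw B (mixedMeasure p B h) := by
  classical
  have hn : (0 : ℝ) < ((B * h : ℕ) : ℝ) := by exact_mod_cast Nat.mul_pos (by omega) (by omega)
  have hd1 : (0 : ℝ) < ((2 * ((B - 1) * h) : ℕ) : ℝ) := by
    exact_mod_cast Nat.mul_pos two_pos (Nat.mul_pos (by omega) (by omega))
  have hd2 : (0 : ℝ) < ((2 * (h - 1) : ℕ) : ℝ) := by
    exact_mod_cast Nat.mul_pos two_pos (by omega)
  have hsupp : ∀ C, (mixedMeasure p B h).real {C} ≠ 0 →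
      ∃ a b : Literal B h, a.1 ≠ b.1 ∧ C = {a, b} := by
    intro C hC
    rw [mixedMeasure_real hp0 hp1 hB hh, typeMeasure, typeMeasure, uniformOn_real_singleton,
      uniformOn_real_singleton] at hC
    by_cases h1 : C ∈ clausesOfType B h [1, 1]
    · obtain ⟨a, b, hab, rfl⟩ := mem_clausesOfType_one_one.1 h1
      exact ⟨a, b, fun h => hab (by rw [h]), rfl⟩
    · by_cases h2 : C ∈ clausesOfType B h [2]
      · obtain ⟨a, b, hab, rfl⟩ := mem_clausesOfType_two.1 h2
        exact ⟨a, b, hab.1, rfl⟩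
      · simp [h1, h2] at hC
  have hb1 : 1 / (((B * h : ℕ) : ℝ) * (2 * ((B - 1) * h) : ℕ)) ≤ B / ((B * h : ℕ) : ℝ) ^ 2 := by
    rw [div_le_div_iff₀ (by positivity) (by positivity)]
    have : B * h ≤ B * (2 * ((B - 1) * h)) :=
      Nat.mul_le_mul_left _ (by nlinarith [Nat.sub_add_cancel (show 1 ≤ B by omega)])
    have : ((B * h : ℕ) : ℝ) ≤ B * ((2 * ((B - 1) * h) : ℕ) : ℝ) := by exact_mod_cast this
    nlinarith
  have hb2 : 1 / (((B * h : ℕ) : ℝ) * (2 * (h - 1) : ℕ)) ≤ B / ((B * h : ℕ) : ℝ) ^ 2 := by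
    rw [div_le_div_iff₀ (by positivity) (by positivity)]
    have : B * h ≤ B * (2 * (h - 1)) := Nat.mul_le_mul_left _ (by omega)
    have : ((B * h : ℕ) : ℝ) ≤ B * ((2 * (h - 1) : ℕ) : ℝ) := by exact_mod_cast this
    nlinarith
  refine ⟨isProbabilityMeasure_mixedMeasure hp0 hp1 hB hh, hsupp, ?_, ?_⟩
  · intro a
    simp only [mixedMeasure_pair hp0 hp1 hB hh]
    rw [Finset.sum_add_distrib, ← Finset.mul_sum, ← Finset.mul_sum, ← Finset.sum_filter,
      ← Finset.sum_filter, Finset.sum_const, Finset.sum_const, card_filter_community_ne,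
      card_filter_community_eq, nsmul_eq_mul, nsmul_eq_mul]
    field_simp
    ring
  · intro C
    by_cases hC : (mixedMeasure p B h).real {C} = 0
    · rw [hC]; positivity
    · obtain ⟨a, b, -, rfl⟩ := hsupp C hC
      rw [mixedMeasure_pair hp0 hp1 hB hh]
      have h0 : (0 : ℝ) ≤ B / ((B * h : ℕ) : ℝ) ^ 2 := by positivity
      have e1 : (if a.1.1 ≠ b.1.1 then 1 / (((B * h : ℕ) : ℝ) * (2 * ((B - 1) * h) : ℕ)) else 0) ≤
          B / ((B * h : ℕ) : ℝ) ^ 2 := by split_ifs <;> assumption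
      have e2 : (if a.1 ≠ b.1 ∧ a.1.1 = b.1.1 then
          1 / (((B * h : ℕ) : ℝ) * (2 * (h - 1) : ℕ)) else 0) ≤
          B / ((B * h : ℕ) : ℝ) ^ 2 := by split_ifs <;> assumption
      nlinarith [mul_le_mul_of_nonneg_left e1 hp0,
        mul_le_mul_of_nonneg_left e2 (sub_nonneg.2 hp1)]

/-! ### Random clauses inside a path -/

/-- In a sequence in which consecutive terms differ, at most about half of the terms have a given
value. -/
lemma length_sub_one_le_of_isChain_ne {α β : Type*} [DecidableEq β] (f : α → β) (i : β) :
    ∀ l : List α, (l.IsChain fun a b => f a ≠ f b) →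
      (l.length : ℝ) - 1 ≤ 2 * (l.map fun b => if i ≠ f b then (1 : ℝ) else 0).sum
  | [], _ => by simp
  | [a], _ => by simp; split_ifs <;> norm_num
  | a :: b :: l, hch => by
    rw [List.isChain_cons_cons] at hch
    have ih := length_sub_one_le_of_isChain_ne f i l hch.2.of_cons
    have : (1 : ℝ) ≤ (if i ≠ f a then (1 : ℝ) else 0) + (if i ≠ f b then (1 : ℝ) else 0) := by
      by_cases h1 : i = f a
      · by_cases h2 : i = f b
        · exact absurd (h1.symm.trans h2) hch.1
        · simp [h1, h1 ▸ h2]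
      · simp only [ne_eq, h1, not_false_eq_true, if_true]
        split_ifs <;> norm_num
    simp only [List.length_cons, List.map_cons, List.sum_cons]
    push_cast
    linarith

/-- The number of ordered pairs with the same value of `f` is at least what it is for a uniform
distribution of the values. -/
lemma sq_card_le_card_mul_sum_pairs {α β : Type*} [DecidableEq β] [Fintype β] (f : α → β)
    (L : Finset α) : (L.card : ℝ) ^ 2 ≤
      Fintype.card β * ∑ a ∈ L, ∑ b ∈ L, if f a = f b then (1 : ℝ) else 0 := by
  have h1 := sq_sum_le_card_mul_sum_sq (s := (Finset.univ : Finset β))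
    (f := fun i => ∑ a ∈ L, if f a = i then (1 : ℝ) else 0)
  have h2 : ∑ i, ∑ a ∈ L, (if f a = i then (1 : ℝ) else 0) = L.card := by
    rw [Finset.sum_comm]; simp
  have h3 : ∑ i, (∑ a ∈ L, if f a = i then (1 : ℝ) else 0) ^ 2 =
      ∑ a ∈ L, ∑ b ∈ L, if f a = f b then (1 : ℝ) else 0 := by
    simp_rw [sq, Finset.sum_mul_sum]
    rw [Finset.sum_comm]
    refine Finset.sum_congr rfl fun a _ => ?_
    rw [Finset.sum_comm]
    refine Finset.sum_congr rfl fun b _ => ?_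
    simp [eq_comm]
  rwa [h2, h3, Finset.card_univ] at h1

lemma le_prob_clause_subset_of_lt_one {p : ℝ} (hp0 : 0 ≤ p) (hp1 : p < 1) {B h : ℕ} (hB : 2 ≤ B)
    (hh : 2 ≤ h) {l : List (Literal B h)} (hnd : (l.map Prod.fst).Nodup) (hl : 2 * B ≤ l.length) :
    (1 - p) / (8 * B) * (l.length / ((B * h : ℕ) : ℝ)) ^ 2 ≤
      (mixedMeasure p B h).real {C | ∀ x ∈ C, x ∈ l} := by
  classical
  have := isProbabilityMeasure_mixedMeasure hp0 hp1.le hB hh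
  have h1 := sum_pairs_le (mixedMeasure p B h) l.toFinset
  simp only [List.mem_toFinset] at h1
  have h2 := sq_card_le_card_mul_sum_pairs (fun a : Literal B h => a.1.1) l.toFinset
  rw [List.toFinset_card_of_nodup (List.Nodup.of_map _ hnd), Fintype.card_fin] at h2
  set n : ℝ := ((B * h : ℕ) : ℝ) with hn
  have hn0 : 0 < n := by rw [hn]; exact_mod_cast Nat.mul_pos (by omega) (by omega)
  have hBpos : (0 : ℝ) < B := by exact_mod_cast (by omega : 0 < B)
  set s : ℝ := (l.length : ℝ) with hs
  set E := ∑ a ∈ l.toFinset, ∑ b ∈ l.toFinset, if a.1.1 = b.1.1 then (1 : ℝ) else 0 with hE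
  have h3 : (1 - p) / (2 * n ^ 2) * (E - s) ≤ ∑ a ∈ l.toFinset, ∑ b ∈ l.toFinset,
      (mixedMeasure p B h).real {({a, b} : Clause B h)} := by
    have : E - s = ∑ a ∈ l.toFinset, ∑ b ∈ l.toFinset,
        ((if a.1.1 = b.1.1 then (1 : ℝ) else 0) - if a = b then 1 else 0) := by
      simp_rw [Finset.sum_sub_distrib]
      rw [hE]
      congr 1
      rw [Finset.sum_congr rfl (g := fun _ => (1 : ℝ)) (fun a ha => by simpa using ha)]
      simp [List.toFinset_card_of_nodup (List.Nodup.of_map _ hnd), hs]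
    rw [this, Finset.mul_sum]
    refine Finset.sum_le_sum fun a ha => ?_
    rw [Finset.mul_sum]
    refine Finset.sum_le_sum fun b hb => ?_
    rw [List.mem_toFinset] at ha hb
    by_cases hab : a = b
    · simp [hab]
    by_cases hc : a.1.1 = b.1.1
    · have hv : a.1 ≠ b.1 := fun hv => hab (List.inj_on_of_nodup_map hnd ha hb hv)
      rw [mixedMeasure_pair hp0 hp1.le hB hh]
      simp only [hc, hab, hv, if_true, if_false, ne_eq, not_true_eq_false, not_false_eq_true,
        and_true, mul_zero, zero_add, sub_zero, mul_one]
      rw [← hn, div_eq_mul_one_div]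
      refine mul_le_mul_of_nonneg_left ?_ (by linarith)
      have hd2 : (0 : ℝ) < ((2 * (h - 1) : ℕ) : ℝ) := by
        exact_mod_cast Nat.mul_pos two_pos (by omega)
      refine one_div_le_one_div_of_le (by positivity) ?_
      have : ((2 * (h - 1) : ℕ) : ℝ) ≤ 2 * n := by
        rw [hn]
        exact_mod_cast (by nlinarith [Nat.sub_le h 1] : 2 * (h - 1) ≤ 2 * (B * h))
      nlinarith
    · simp [hab, hc]
  have hsB : 2 * (B : ℝ) ≤ s := by rw [hs]; exact_mod_cast hl
  have h4 : s ^ 2 / (2 * B) ≤ E - s := by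
    rw [div_le_iff₀ (by positivity)]
    nlinarith
  have h5 : (1 - p) / (2 * n ^ 2) * (s ^ 2 / (2 * B)) ≤ (1 - p) / (2 * n ^ 2) * (E - s) :=
    mul_le_mul_of_nonneg_left h4 (div_nonneg (by linarith) (by positivity))
  have h6 : (1 - p) / (8 * B) * (s / n) ^ 2 = (1 - p) / (2 * n ^ 2) * (s ^ 2 / (2 * B)) / 2 := by
    field_simp; ring
  rw [h6]
  linarith

lemma le_prob_clause_subset_of_eq_one {B h : ℕ} (hB : 2 ≤ B)
    (hh : 2 ≤ h) {l : List (Literal B h)} (hnd : (l.map Prod.fst).Nodup) (hl : 2 ≤ l.length)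
    (hch : l.IsChain fun a b => a.1.1 ≠ b.1.1) :
    1 / 16 * (l.length / ((B * h : ℕ) : ℝ)) ^ 2 ≤
      (mixedMeasure 1 B h).real {C | ∀ x ∈ C, x ∈ l} := by
  classical
  have := isProbabilityMeasure_mixedMeasure zero_le_one le_rfl hB hh
  have h1 := sum_pairs_le (mixedMeasure 1 B h) l.toFinset
  simp only [List.mem_toFinset] at h1
  set n : ℝ := ((B * h : ℕ) : ℝ) with hn
  have hn0 : 0 < n := by rw [hn]; exact_mod_cast Nat.mul_pos (by omega) (by omega)
  set s : ℝ := (l.length : ℝ) with hs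
  have hnd' : l.Nodup := List.Nodup.of_map _ hnd
  have h3 : s * (1 / (2 * n ^ 2) * ((s - 1) / 2)) ≤ ∑ a ∈ l.toFinset, ∑ b ∈ l.toFinset,
      (mixedMeasure 1 B h).real {({a, b} : Clause B h)} := by
    have : s * (1 / (2 * n ^ 2) * ((s - 1) / 2)) =
        ∑ a ∈ l.toFinset, (1 / (2 * n ^ 2) * ((s - 1) / 2)) := by
      rw [Finset.sum_const, nsmul_eq_mul, List.toFinset_card_of_nodup hnd']
    rw [this]
    refine Finset.sum_le_sum fun a _ => ?_
    have h4 := length_sub_one_le_of_isChain_ne (fun b : Literal B h => b.1.1) a.1.1 l hch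
    rw [← List.sum_toFinset _ hnd'] at h4
    calc 1 / (2 * n ^ 2) * ((s - 1) / 2) ≤ 1 / (2 * n ^ 2) *
          ∑ b ∈ l.toFinset, (if a.1.1 ≠ b.1.1 then (1 : ℝ) else 0) :=
          mul_le_mul_of_nonneg_left (by linarith) (by positivity)
      _ ≤ _ := by
        rw [Finset.mul_sum]
        refine Finset.sum_le_sum fun b _ => ?_
        rw [mixedMeasure_pair zero_le_one le_rfl hB hh, ← hn]
        by_cases hc : a.1.1 = b.1.1
        · simp [hc]
        · simp only [ne_eq, hc, not_false_eq_true, if_true, mul_one, one_mul, sub_self, zero_mul,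
            add_zero]
          have hd1 : (0 : ℝ) < ((2 * ((B - 1) * h) : ℕ) : ℝ) := by
            exact_mod_cast Nat.mul_pos two_pos (Nat.mul_pos (by omega) (by omega))
          refine one_div_le_one_div_of_le (by positivity) ?_
          have : ((2 * ((B - 1) * h) : ℕ) : ℝ) ≤ 2 * n := by
            rw [hn]
            exact_mod_cast Nat.mul_le_mul_left 2 (Nat.mul_le_mul_right h (Nat.sub_le B 1))
          nlinarith
  have hs2 : 2 ≤ s := by rw [hs]; exact_mod_cast hl
  have h5 : 1 / 16 * (s / n) ^ 2 ≤ s * (1 / (2 * n ^ 2) * ((s - 1) / 2)) / 2 := by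
    have e1 : 1 / 16 * (s / n) ^ 2 = 1 / n ^ 2 * (s * s / 16) := by field_simp
    have e2 : s * (1 / (2 * n ^ 2) * ((s - 1) / 2)) / 2 = 1 / n ^ 2 * (s * (s - 1) / 8) := by
      field_simp; ring
    rw [e1, e2]
    exact mul_le_mul_of_nonneg_left (by nlinarith) (by positivity)
  linarith

/-- A random clause lies inside a given path, or inside the negation of a given path, with
probability at least of the order of the square of the fraction of variables on the path. For
`p < 1` this is due to the pairs inside a community; for `p = 1` consecutive variables on the path
lie in different communities. -/
theorem exists_le_prob_clause_subset {p : ℝ} (hp0 : 0 ≤ p) (hp1 : p ≤ 1) {B : ℕ} (hB : 2 ≤ B) :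
    ∃ c : ℝ, 0 < c ∧ ∀ h, 2 ≤ h → ∀ l : List (Literal B h), 2 * B ≤ l.length →
      (l.map Prod.fst).Nodup →
      l.IsChain (fun a b => (mixedMeasure p B h).real {({neg b, a} : Clause B h)} ≠ 0) →
      c * (l.length / ((B * h : ℕ) : ℝ)) ^ 2 ≤ (mixedMeasure p B h).real {C | ∀ x ∈ C, x ∈ l} ∧
      c * (l.length / ((B * h : ℕ) : ℝ)) ^ 2 ≤
        (mixedMeasure p B h).real {C | ∀ x ∈ C, neg x ∈ l} := by
  have hneg : ∀ {h : ℕ} (l : List (Literal B h)), {C : Clause B h | ∀ x ∈ C, neg x ∈ l} =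
      {C | ∀ x ∈ C, x ∈ l.map neg} := by
    intro h l
    have : ∀ x : Literal B h, neg x ∈ l ↔ x ∈ l.map neg := by
      intro x
      rw [List.mem_map]
      exact ⟨fun hx => ⟨_, hx, neg_neg x⟩, fun ⟨y, hy, hyx⟩ => by rwa [← hyx, neg_neg]⟩
    simp only [this]
  have hfst : ∀ {h : ℕ} (l : List (Literal B h)), (l.map neg).map Prod.fst = l.map Prod.fst := by
    intro h l
    rw [List.map_map]
    rfl
  rcases hp1.lt_or_eq with hp | rfl
  · refine ⟨(1 - p) / (8 * B), ?_, fun h hh l hl hnd _ => ⟨?_, ?_⟩⟩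
    · have : (0 : ℝ) < B := by exact_mod_cast (by omega : 0 < B)
      have : 0 < 1 - p := by linarith
      positivity
    · exact le_prob_clause_subset_of_lt_one hp0 hp hB hh hnd hl
    · rw [hneg, ← List.length_map neg]
      exact le_prob_clause_subset_of_lt_one hp0 hp hB hh (by rwa [hfst]) (by simpa using hl)
  · refine ⟨1 / 16, by norm_num, fun h hh l hl hnd hch => ?_⟩
    have hch' : l.IsChain fun a b => a.1.1 ≠ b.1.1 := by
      refine hch.imp fun a b hab hc => hab ?_
      rw [mixedMeasure_pair zero_le_one le_rfl hB hh]
      simp [hc]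
    refine ⟨le_prob_clause_subset_of_eq_one hB hh hnd (by omega) hch', ?_⟩
    rw [hneg, ← List.length_map neg]
    refine le_prob_clause_subset_of_eq_one hB hh (by rwa [hfst]) (by simp; omega) ?_
    rw [List.isChain_map]
    exact hch'

/-! ### Unsatisfiability above density one -/

lemma exp_neg_le_quadratic {x : ℝ} (hx : 0 ≤ x) : Real.exp (-x) ≤ 1 - x + x ^ 2 / 2 := by
  have h1 := Real.quadratic_le_exp_of_nonneg hx
  have h2 : 0 < 1 + x + x ^ 2 / 2 := by positivity
  rw [Real.exp_neg]
  calc (Real.exp x)⁻¹ ≤ (1 + x + x ^ 2 / 2)⁻¹ := inv_anti₀ h2 h1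
    _ ≤ 1 - x + x ^ 2 / 2 := by
      rw [inv_le_iff_one_le_mul₀ h2]
      nlinarith [sq_nonneg (x ^ 2)]

/-- The tilted weights of the two answers to a query of probability `q` add up to at most one; `c`
bounds the quadratic error of the exponential. -/
lemma add_exp_neg_le_exp_neg {M k c q lam : ℝ} (hk : 0 ≤ k) (hkM : k ≤ M) (hq : 0 ≤ q)
    (hMq : M ^ 2 * q ≤ 2 * c) : M * q * Real.exp (-lam) + Real.exp (-((M - k) * q)) ≤
      Real.exp (-((M * (1 - Real.exp (-lam)) - k - c) * q)) := by
  have h1 := exp_neg_le_quadratic (mul_nonneg (sub_nonneg.2 hkM) hq)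
  have h2 := Real.add_one_le_exp (-((M * (1 - Real.exp (-lam)) - k - c) * q))
  have h3 : ((M - k) * q) ^ 2 / 2 ≤ c * q := by
    have h4 : (M - k) ^ 2 * q ≤ M ^ 2 * q :=
      mul_le_mul_of_nonneg_right (pow_le_pow_left₀ (sub_nonneg.2 hkM) (by linarith) 2) hq
    have h5 : (M - k) ^ 2 * q * q ≤ 2 * c * q := mul_le_mul_of_nonneg_right (h4.trans hMq) hq
    linarith
  linarith

/-- The tilt parameters: for `ρ > 1`, a small tilt `lam` of the number of positive answers is
outweighed by the tilt of the probability queried, even after small losses. -/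
lemma exists_tilt {ρ K : ℝ} (hρ : 1 < ρ) :
    ∃ lam δ : ℝ, 0 < lam ∧ 0 < δ ∧ δ < 1 ∧ 2 * K * δ < 1 ∧ 2 * δ < ρ * (1 - Real.exp (-lam)) ∧
      lam < (ρ * (1 - Real.exp (-lam)) - 2 * δ) * (1 - δ) * (1 - 2 * K * δ) := by
  have hρ0 : 0 < ρ := by linarith
  set lam := (ρ - 1) / ρ with hl
  have hlam : 0 < lam := div_pos (by linarith) hρ0
  have h1 : lam < ρ * (1 - Real.exp (-lam)) := by
    have h2 := exp_neg_le_quadratic hlam.le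
    have h3 : ρ * lam = ρ - 1 := by rw [hl]; field_simp
    have h4 : ρ * (lam - lam ^ 2 / 2) ≤ ρ * (1 - Real.exp (-lam)) :=
      mul_le_mul_of_nonneg_left (by linarith) hρ0.le
    have h5 : ρ * (lam - lam ^ 2 / 2) = lam * (ρ + 1) / 2 := by
      have : ρ * (lam - lam ^ 2 / 2) = lam * (ρ - ρ * lam / 2) := by ring
      rw [this, h3]; ring
    nlinarith
  set c := ρ * (1 - Real.exp (-lam)) with hc
  have e1 : ∀ᶠ δ : ℝ in 𝓝 0, lam < (c - 2 * δ) * (1 - δ) * (1 - 2 * K * δ) := by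
    have : Continuous fun δ : ℝ => (c - 2 * δ) * (1 - δ) * (1 - 2 * K * δ) := by fun_prop
    exact this.continuousAt.eventually (lt_mem_nhds (by simpa using h1))
  have e2 : ∀ᶠ δ : ℝ in 𝓝 0, 2 * K * δ < 1 := by
    have : Continuous fun δ : ℝ => 2 * K * δ := by fun_prop
    exact this.continuousAt.eventually (gt_mem_nhds (by simp))
  have e3 : ∀ᶠ δ : ℝ in 𝓝 0, 2 * δ < c := by
    have : Continuous fun δ : ℝ => 2 * δ := by fun_prop
    exact this.continuousAt.eventually (gt_mem_nhds (by simp; linarith))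
  have e4 : ∀ᶠ δ : ℝ in 𝓝 0, δ < 1 := gt_mem_nhds one_pos
  obtain ⟨δ, ⟨⟨⟨⟨h1, h2⟩, h3⟩, h4⟩, h5⟩⟩ :=
    (((((e1.and e2).and e3).and e4).filter_mono (nhdsWithin_le_nhds (s := Set.Ioi 0))).and
      self_mem_nhdsWithin).exists
  exact ⟨lam, δ, hlam, h5, h4, h2, h3, h1⟩

/-- Above density one, there is with high probability an implication path through a positive
fraction of the variables. -/
theorem exists_tendsto_prob_not_hasLongPath {B : ℕ} (hB : 0 < B) {K ρ : ℝ} (hρ : 1 < ρ)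
    {P : (h : ℕ) → Measure (Clause B h)} (hP : ∀ h, 2 ≤ h → IsSpreadLaw K (P h)) :
    ∃ β : ℝ, 0 < β ∧ ∀ m : ℕ → ℕ, (∀ᶠ h in atTop, ρ * ((B * h : ℕ) : ℝ) ≤ m h ∧
      (m h : ℝ) ≤ (ρ + 1) * ((B * h : ℕ) : ℝ)) →
      Tendsto (fun h => (randomFormula (m h) (P h)).real
        {I | ¬ HasLongPath (P h) (2 * ⌊β * ((B * h : ℕ) : ℝ)⌋₊) I}) atTop (𝓝 0) := by
  obtain ⟨lam, δ, hlam, hδ, hδ1, hKδ, hcδ, hmain⟩ := exists_tilt (K := K) hρ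
  refine ⟨δ ^ 2 / 4, by positivity, fun m hm => ?_⟩
  set a := ρ * (1 - Real.exp (-lam)) with ha
  set γ := (a - 2 * δ) * (1 - δ) * (1 - 2 * K * δ) - lam with hγ
  have hγ0 : 0 < γ := by linarith
  have hn := tendsto_card_var hB
  have hK : 0 ≤ K := by
    have h1 := measureReal_nonneg.trans ((hP 2 le_rfl).le ∅)
    have h2 : (0 : ℝ) < ((B * 2 : ℕ) : ℝ) ^ 2 := by positivity
    by_contra hneg
    exact absurd h1 (not_le.2 (div_neg_of_neg_of_pos (not_le.1 hneg) h2))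
  set c : ℝ := (ρ + 1) ^ 2 * K / 2 with hc
  have hc0 : 0 ≤ c := by positivity
  have hlim : Tendsto (fun h : ℕ => Real.exp (-(γ * (δ / 2) * ((B * h : ℕ) : ℝ)))) atTop (𝓝 0) :=
    Real.tendsto_exp_neg_atTop_nhds_zero.comp (hn.const_mul_atTop (by positivity))
  refine tendsto_of_tendsto_of_tendsto_of_le_of_le' tendsto_const_nhds hlim
    (Eventually.of_forall fun _ => measureReal_nonneg) ?_
  filter_upwards [hm, eventually_ge_atTop 2, hn.eventually_ge_atTop (2 / δ),
    hn.eventually_ge_atTop (c / δ)] with h hmh hh hn1 hn2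
  set n : ℝ := ((B * h : ℕ) : ℝ) with hndef
  have hn0 : 0 < n := by rw [hndef]; exact_mod_cast Nat.mul_pos hB (by omega)
  rw [div_le_iff₀ hδ] at hn1 hn2
  set k : ℕ := ⌊δ * n⌋₊ with hk
  have hkle : (k : ℝ) ≤ δ * n := Nat.floor_le (by positivity)
  have hkge : δ / 2 * n ≤ k := by
    have := Nat.lt_floor_add_one (δ * n)
    rw [← hk] at this
    linarith
  have hkn : (k : ℝ) ≤ n := hkle.trans (mul_le_of_le_one_left hn0.le hδ1.le)
  set ℓ : ℕ := 2 * ⌊δ ^ 2 / 4 * n⌋₊ with hℓ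
  have hℓle : (ℓ : ℝ) ≤ δ * k := by
    have : (⌊δ ^ 2 / 4 * n⌋₊ : ℝ) ≤ δ ^ 2 / 4 * n := Nat.floor_le (by positivity)
    have := mul_le_mul_of_nonneg_left hkge hδ.le
    rw [hℓ]
    push_cast
    linarith
  have hkm : k ≤ m h := by
    have : (k : ℝ) ≤ m h := hkn.trans ((le_mul_of_one_le_left hn0.le hρ.le).trans hmh.1)
    exact_mod_cast this
  have hkBh : k ≤ B * h := by
    rw [hndef] at hkn
    exact_mod_cast hkn
  have he1 : 0 < 1 - Real.exp (-lam) := by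
    have : Real.exp (-lam) < 1 := Real.exp_lt_one_iff.2 (by linarith)
    linarith
  set θ : ℝ := m h * (1 - Real.exp (-lam)) - k - c with hθ
  have hθge : n * (a - 2 * δ) ≤ θ := by
    have := mul_le_mul_of_nonneg_right hmh.1 he1.le
    rw [hθ, ha]
    linarith
  have hθ0 : 0 ≤ θ := le_trans (mul_nonneg hn0.le (by linarith)) hθge
  have hrow : (1 - 2 * K * δ) / n ≤ 1 / n - 2 * k * (K / n ^ 2) := by
    have : 1 / n - 2 * k * (K / n ^ 2) = (1 - 2 * K * (k / n)) / n := by field_simp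
    rw [this]
    have h2 : (k : ℝ) / n ≤ δ := by rw [div_le_iff₀ hn0]; exact hkle
    refine div_le_div_of_nonneg_right ?_ hn0.le
    have := mul_le_mul_of_nonneg_left h2 (by positivity : 0 ≤ 2 * K)
    linarith
  have hrow0 : 0 ≤ (1 - 2 * K * δ) / n := div_nonneg (by linarith) hn0.le
  have hstep : ∀ q : ℝ, 0 ≤ q → q ≤ K / n ^ 2 →
      m h * q * Real.exp (-lam) + Real.exp (-((m h - k) * q)) ≤ Real.exp (-(θ * q)) := by
    intro q hq0 hq
    refine add_exp_neg_le_exp_neg (Nat.cast_nonneg k) (by exact_mod_cast hkm) hq0 ?_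
    calc (m h : ℝ) ^ 2 * q ≤ ((ρ + 1) * n) ^ 2 * (K / n ^ 2) :=
          mul_le_mul (pow_le_pow_left₀ (Nat.cast_nonneg _) hmh.2 2) hq hq0 (by positivity)
      _ = 2 * c := by rw [hc]; field_simp
  refine (prob_not_hasLongPath_le (hP h hh) hkm hkBh hlam.le hθ0 hstep (hrow0.trans hrow)
    le_rfl).trans (Real.exp_le_exp.2 ?_)
  rw [← hndef]
  have hQ : (k : ℝ) * (1 - δ) * ((1 - 2 * K * δ) / n) ≤
      ((k : ℝ) - ℓ) * (1 / n - 2 * k * (K / n ^ 2)) := by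
    refine mul_le_mul (by linarith) hrow hrow0 ?_
    have : δ * k ≤ 1 * k := mul_le_mul_of_nonneg_right hδ1.le (Nat.cast_nonneg k)
    linarith
  have hQ0 : 0 ≤ (k : ℝ) * (1 - δ) * ((1 - 2 * K * δ) / n) :=
    mul_nonneg (mul_nonneg (Nat.cast_nonneg k) (by linarith)) hrow0
  have hprod := mul_le_mul hθge hQ hQ0 hθ0
  have heq : n * (a - 2 * δ) * (k * (1 - δ) * ((1 - 2 * K * δ) / n)) = k * (γ + lam) := by
    rw [hγ]
    field_simp
    ring
  rw [heq] at hprod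
  have hγk := mul_le_mul_of_nonneg_left hkge hγ0.le
  linarith

/-- Above density one, a random formula is unsatisfiable with high probability: a part of the
clauses of density still above one creates a path through a positive fraction of the variables, and
the remaining linearly many clauses contradict it. -/
theorem tendsto_prob_satisfiable_of_one_lt {p : ℝ} (hp0 : 0 ≤ p) (hp1 : p ≤ 1) {B : ℕ}
    (hB : 2 ≤ B) {m : ℕ → ℕ} {r : ℝ}
    (hm : Tendsto (fun h => (m h : ℝ) / ((B * h : ℕ) : ℝ)) atTop (𝓝 r)) (hr : 1 < r) :
    Tendsto (fun h => (randomFormula (m h) (mixedMeasure p B h)).real {I | I.Satisfiable})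
      atTop (𝓝 0) := by
  obtain ⟨ρ, hρ, hρr⟩ := exists_between hr
  obtain ⟨ρ', hρρ', hρ'r⟩ := exists_between hρr
  have hB0 : 0 < B := by omega
  obtain ⟨β, hβ, hpath⟩ := exists_tendsto_prob_not_hasLongPath hB0 hρ
    (fun h hh => isSpreadLaw_mixedMeasure hp0 hp1 hB hh)
  obtain ⟨c, hc, hhit⟩ := exists_le_prob_clause_subset hp0 hp1 hB
  set c' := min (c * (β / 2) ^ 2) 1 with hc'
  have hc'0 : 0 < c' := lt_min (by positivity) one_pos
  have hc'1 : c' ≤ 1 := min_le_right _ _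
  have hn := tendsto_card_var hB0
  set m₁ : ℕ → ℕ := fun h => ⌈ρ * ((B * h : ℕ) : ℝ)⌉₊ with hm₁
  have hpath' := hpath m₁ (by
    filter_upwards [hn.eventually_ge_atTop 1] with h h1
    refine ⟨Nat.le_ceil _, ?_⟩
    have := Nat.ceil_lt_add_one (show 0 ≤ ρ * ((B * h : ℕ) : ℝ) by positivity)
    rw [hm₁]
    linarith)
  have hdiff : ∀ᶠ h in atTop, (m₁ h : ℝ) + ((ρ' - ρ) * ((B * h : ℕ) : ℝ) - 1) ≤ m h := by
    filter_upwards [hm.eventually (lt_mem_nhds hρ'r), hn.eventually_ge_atTop 1] with h h1 h2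
    rw [lt_div_iff₀ (by linarith)] at h1
    have := Nat.ceil_lt_add_one (show 0 ≤ ρ * ((B * h : ℕ) : ℝ) by positivity)
    rw [hm₁]
    simp only
    linarith
  have hlin : Tendsto (fun h : ℕ => (ρ' - ρ) * ((B * h : ℕ) : ℝ) - 1) atTop atTop :=
    tendsto_atTop_add_const_right _ _ (hn.const_mul_atTop (by linarith))
  have hle : ∀ᶠ h in atTop, m₁ h ≤ m h := by
    filter_upwards [hdiff, hlin.eventually_ge_atTop 0] with h h1 h2
    have : (m₁ h : ℝ) ≤ m h := by linarith
    exact_mod_cast this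
  have hm₂ : Tendsto (fun h => m h - m₁ h) atTop atTop := by
    rw [← tendsto_natCast_atTop_iff (R := ℝ)]
    refine tendsto_atTop_mono' _ ?_ hlin
    filter_upwards [hdiff, hle] with h h1 h2
    rw [Nat.cast_sub h2]
    linarith
  have hpow : Tendsto (fun h => 2 * (1 - c') ^ (m h - m₁ h)) atTop (𝓝 (2 * 0)) :=
    ((tendsto_pow_atTop_nhds_zero_of_lt_one (by linarith) (by linarith)).comp hm₂).const_mul 2
  have hsum := hpath'.add hpow
  rw [mul_zero, add_zero] at hsum
  refine tendsto_of_tendsto_of_tendsto_of_le_of_le' tendsto_const_nhds hsum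
    (Eventually.of_forall fun _ => measureReal_nonneg) ?_
  filter_upwards [hle, eventually_ge_atTop 2, hn.eventually_ge_atTop (2 / β),
    hn.eventually_ge_atTop ((2 * B + 1) / β)] with h hmle hh hn1 hn2
  have := isProbabilityMeasure_mixedMeasure hp0 hp1 hB hh
  set n : ℝ := ((B * h : ℕ) : ℝ) with hndef
  have hn0 : 0 < n := by rw [hndef]; exact_mod_cast Nat.mul_pos hB0 (by omega)
  rw [div_le_iff₀ hβ] at hn1 hn2
  have hfl := Nat.lt_floor_add_one (β * n)
  have hj : ∀ l : List (Literal B h), ⌊β * n⌋₊ ≤ l.length → (l.map Prod.fst).Nodup →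
      l.IsChain (fun a b => (mixedMeasure p B h).real {({neg b, a} : Clause B h)} ≠ 0) →
      c' ≤ (mixedMeasure p B h).real {C | ∀ x ∈ C, x ∈ l} ∧
      c' ≤ (mixedMeasure p B h).real {C | ∀ x ∈ C, neg x ∈ l} := by
    intro l hl hnd hch
    have hl' : (⌊β * n⌋₊ : ℝ) ≤ l.length := by exact_mod_cast hl
    have h2B : 2 * B ≤ l.length := by
      have : (2 * B : ℝ) ≤ l.length := by linarith
      exact_mod_cast this
    have hfrac : c' ≤ c * (l.length / n) ^ 2 := by
      refine (min_le_left _ _).trans (mul_le_mul_of_nonneg_left ?_ hc.le)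
      refine pow_le_pow_left₀ (by positivity) ?_ 2
      rw [le_div_iff₀ hn0]
      linarith
    obtain ⟨h1, h2⟩ := hhit h hh l h2B hnd hch
    exact ⟨hfrac.trans h1, hfrac.trans h2⟩
  have := prob_satisfiable_add_le (mixedMeasure p B h) hc'1 hj (m₁ h) (m h - m₁ h)
  rwa [Nat.add_sub_cancel' hmle] at this

/-! ### The threshold -/

lemma tendsto_measure_one_of_real_compl {Ω : ℕ → Type*} [∀ h, MeasurableSpace (Ω h)]
    {μ : ∀ h, Measure (Ω h)} (hμ : ∀ᶠ h in atTop, IsProbabilityMeasure (μ h)) {s : ∀ h, Set (Ω h)}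
    (hs : ∀ h, MeasurableSet (s h)) (hlim : Tendsto (fun h => (μ h).real (s h)ᶜ) atTop (𝓝 0)) :
    Tendsto (fun h => μ h (s h)) atTop (𝓝 1) := by
  have h1 := ENNReal.tendsto_ofReal (hlim.const_sub 1)
  rw [sub_zero, ENNReal.ofReal_one] at h1
  refine h1.congr' ?_
  filter_upwards [hμ] with h hh
  rw [probReal_compl_eq_one_sub (hs h), sub_sub_cancel, ofReal_measureReal]

lemma eventually_isProbabilityMeasure_randomFormula {p : ℝ} (hp0 : 0 ≤ p) (hp1 : p ≤ 1) {B : ℕ}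
    (hB : 2 ≤ B) (m : ℕ → ℕ) :
    ∀ᶠ h in atTop, IsProbabilityMeasure (randomFormula (m h) (mixedMeasure p B h)) := by
  filter_upwards [eventually_ge_atTop 2] with h hh
  have := isProbabilityMeasure_mixedMeasure hp0 hp1 hB hh
  infer_instance

theorem satWhp_of_lt_one {p : ℝ} (hp0 : 0 ≤ p) (hp1 : p ≤ 1) {B : ℕ} (hB : 2 ≤ B) {m : ℕ → ℕ}
    {r : ℝ} (hm : Tendsto (fun h => (m h : ℝ) / ((B * h : ℕ) : ℝ)) atTop (𝓝 r)) (hr : r < 1) :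
    SatWhp B (mixedMeasure p B) m :=
  tendsto_measure_one_of_real_compl (eventually_isProbabilityMeasure_randomFormula hp0 hp1 hB m)
    (fun _ => (Set.toFinite _).measurableSet)
    (tendsto_prob_not_satisfiable_of_lt_one (by omega)
      (fun _ hh => isSpreadLaw_mixedMeasure hp0 hp1 hB hh) hm hr)

theorem unsatWhp_of_one_lt {p : ℝ} (hp0 : 0 ≤ p) (hp1 : p ≤ 1) {B : ℕ} (hB : 2 ≤ B) {m : ℕ → ℕ}
    {r : ℝ} (hm : Tendsto (fun h => (m h : ℝ) / ((B * h : ℕ) : ℝ)) atTop (𝓝 r)) (hr : 1 < r) :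
    UnsatWhp B (mixedMeasure p B) m := by
  refine tendsto_measure_one_of_real_compl
    (eventually_isProbabilityMeasure_randomFormula hp0 hp1 hB m)
    (fun _ => (Set.toFinite _).measurableSet) ?_
  refine (tendsto_prob_satisfiable_of_one_lt hp0 hp1 hB hm hr).congr fun h => ?_
  congr 1
  ext I
  simp

lemma not_satWhp_and_unsatWhp {p : ℝ} (hp0 : 0 ≤ p) (hp1 : p ≤ 1) {B : ℕ} (hB : 2 ≤ B)
    {m : ℕ → ℕ} (hs : SatWhp B (mixedMeasure p B) m) (hu : UnsatWhp B (mixedMeasure p B) m) :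
    False := by
  have h1 := hs.add hu
  have h2 : Tendsto (fun h => randomFormula (m h) (mixedMeasure p B h) {I | I.Satisfiable} +
      randomFormula (m h) (mixedMeasure p B h) {I | ¬ I.Satisfiable}) atTop (𝓝 1) := by
    refine tendsto_const_nhds.congr' ?_
    filter_upwards [eventually_isProbabilityMeasure_randomFormula hp0 hp1 hB m] with h hh
    exact (prob_add_prob_compl (Set.toFinite {I : Formula B h (m h) |
      I.Satisfiable}).measurableSet).symm
  have h3 := tendsto_nhds_unique h1 h2
  norm_num at h3

lemma tendsto_clausesAtDensity {B : ℕ} (hB : 0 < B) {α : ℝ} (hα : 0 ≤ α) :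
    Tendsto (fun h => (clausesAtDensity B α h : ℝ) / ((B * h : ℕ) : ℝ)) atTop (𝓝 α) :=
  (tendsto_nat_floor_mul_div_atTop hα).comp (tendsto_card_var hB)

theorem isSatThreshold_one {p : ℝ} (hp0 : 0 ≤ p) (hp1 : p ≤ 1) {B : ℕ} (hB : 2 ≤ B) :
    IsSatThreshold B (mixedMeasure p B) 1 := by
  have hB0 : 0 < B := by omega
  have hsat : ∀ α : ℝ, 0 ≤ α → α < 1 → SatWhp B (mixedMeasure p B) (clausesAtDensity B α) :=
    fun α hα hα1 => satWhp_of_lt_one hp0 hp1 hB (tendsto_clausesAtDensity hB0 hα) hα1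
  have hunsat : ∀ α : ℝ, 1 < α → UnsatWhp B (mixedMeasure p B) (clausesAtDensity B α) :=
    fun α hα =>
      unsatWhp_of_one_lt hp0 hp1 hB (tendsto_clausesAtDensity hB0 (zero_le_one.trans hα.le)) hα
  refine ⟨⟨?_, ?_⟩, ⟨?_, ?_⟩⟩
  · rintro α ⟨-, hα⟩
    by_contra hlt
    exact not_satWhp_and_unsatWhp hp0 hp1 hB hα (hunsat α (not_le.1 hlt))
  · intro b hb
    refine le_of_forall_lt_imp_le_of_dense fun α hα => ?_
    rcases le_total 0 α with h0 | h0
    · exact hb ⟨h0, hsat α h0 hα⟩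
    · exact h0.trans (hb ⟨le_rfl, hsat 0 le_rfl one_pos⟩)
  · rintro α ⟨hα0, hα⟩
    by_contra hlt
    exact not_satWhp_and_unsatWhp hp0 hp1 hB (hsat α hα0 (not_le.1 hlt)) hα
  · intro b hb
    exact le_of_forall_gt_imp_ge_of_dense fun α hα => hb ⟨zero_le_one.trans hα.le, hunsat α hα⟩

end CommunitySat

theorem mainTheorem3 (p : ℝ) (hp0 : 0 ≤ p) (hp1 : p ≤ 1) (B : ℕ) (hB : 2 ≤ B) :
    CommunitySat.IsSatThreshold B (CommunitySat.mixedMeasure p B) 1 ∧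
    ∀ (m : ℕ → ℕ) (r : ℝ),
      Tendsto (fun h => (m h : ℝ) / ((B * h : ℕ) : ℝ)) atTop (𝓝 r) →
      (r < 1 → CommunitySat.SatWhp B (CommunitySat.mixedMeasure p B) m) ∧
      (1 < r → CommunitySat.UnsatWhp B (CommunitySat.mixedMeasure p B) m) := by
  exact ⟨CommunitySat.isSatThreshold_one hp0 hp1 hB, fun m r hm =>
    ⟨CommunitySat.satWhp_of_lt_one hp0 hp1 hB hm, CommunitySat.unsatWhp_of_one_lt hp0 hp1 hB hm⟩⟩
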